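/- Let $f\colon Y\to X$ be a continuous map of topological spaces that is separated (the diagonal is closed in $Y\times_X Y$) and locally proper (for every $y\in Y$ and every neighborhood $V$ of $y$ there are a neighborhood $A\subset V$ of $y$ and a neighborhood $U$ of $f(y)$ with $f(A)\subset U$ such that the induced map $A\to U$ is proper, i.e. universally closed). Write $\operatorname{Sh}(Y)$ for the category of sheaves of abelian groups on $Y$ and $D^+(Y)$ for the full subcategory of its derived category $D(\operatorname{Sh}(Y))$ consisting of the complexes whose cohomology sheaves are bounded below; similarly for $X$. Let $f_{(!)}\colon \operatorname{Sh}(Y)\to\operatorname{Sh}(X)$ be the proper direct image functor, $$(f_{(!)}\mathcal F)(U)=\{s\in\mathcal F(f^{-1}(U)) \mid f\colon \operatorname{supp}(s)\to U \text{ is proper}\},$$ and let $f_!=\mathrm R f_{(!)}\colon D^+(Y)\to D^+(X)$ be its right derived functor. Assume that $f_{(!)}$ has finite cohomological dimension, i.e. there is $d\in\mathbb N$ such that $\mathrm R^p f_{(!)}\mathcal F=0$ for all $p>d$ and all $\mathcal F\in\operatorname{Sh}(Y)$. Then $f_!\colon D^+(Y)\to D^+(X)$ has a right adjoint functor $f^!\colon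 D^+(X)\to D^+(Y)$. -/

import Mathlib

open CategoryTheory TopologicalSpace Opposite Topology

universe u w₁ w₂

/-- `f` maps `A` into `U`, and the induced map `A → U` of topological spaces (with the subspace
topologies) is proper. -/
def MapsProperly {Y X : Type*} [TopologicalSpace Y] [TopologicalSpace X]
    (f : Y → X) (A : Set Y) (U : Set X) : Prop :=
  ∃ h : Set.MapsTo f A U, IsProperMap (h.restrict f A U)

/-- Locally proper maps: `f` is continuous and every neighborhood `V` of a point `y` contains a
neighborhood `A` of `y` such that `f` induces a proper map from `A` to some neighborhood of
`f y`. -/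
def IsLocallyProperMap {Y X : Type*} [TopologicalSpace Y] [TopologicalSpace X]
    (f : Y → X) : Prop :=
  Continuous f ∧ ∀ y : Y, ∀ V ∈ 𝓝 y, ∃ A ∈ 𝓝 y, A ⊆ V ∧ ∃ U ∈ 𝓝 (f y), MapsProperly f A U

theorem mapsProperly_iff {Y X : Type*} [TopologicalSpace Y] [TopologicalSpace X]
    {f : Y → X} (hf : Continuous f) {A : Set Y} {U : Set X} :
    MapsProperly f A U ↔ Set.MapsTo f A U ∧ ∀ 𝒰 : Ultrafilter Y, A ∈ 𝒰 → ∀ x ∈ U,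
      Filter.Tendsto f 𝒰 (𝓝 x) → ∃ y ∈ A, f y = x ∧ (𝒰 : Filter Y) ≤ 𝓝 y := by
  refine ⟨fun ⟨h, hp⟩ ↦ ⟨h, fun 𝒰 hA x hx ht ↦ ?_⟩, fun ⟨h, hu⟩ ↦ ⟨h, ?_⟩⟩
  · have hr : Set.range (Subtype.val : A → Y) ∈ 𝒰 := by simpa using hA
    let 𝒱 : Ultrafilter A := 𝒰.comap Subtype.val_injective hr
    have h𝒱 : Filter.map Subtype.val (𝒱 : Filter A) = 𝒰 := by
      rw [Ultrafilter.coe_comap, Filter.map_comap_of_mem hr]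
    have ht' : Filter.Tendsto (h.restrict f A U) 𝒱 (𝓝 ⟨x, hx⟩) := by
      rw [nhds_subtype, Filter.tendsto_comap_iff]
      have : Filter.Tendsto f (Filter.map Subtype.val (𝒱 : Filter A)) (𝓝 x) := by rwa [h𝒱]
      exact this
    obtain ⟨y, hy, hle⟩ := hp.ultrafilter_le_nhds_of_tendsto ht'
    refine ⟨y, y.2, congrArg Subtype.val hy, ?_⟩
    rw [← h𝒱]
    exact (Filter.map_mono hle).trans continuous_subtype_val.continuousAt
  · refine isProperMap_iff_ultrafilter.mpr ⟨hf.restrict h, fun 𝒱 x ht ↦ ?_⟩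
    obtain ⟨y, hy, hyx, hle⟩ := hu (𝒱.map Subtype.val) (by
      rw [Ultrafilter.mem_map, Subtype.coe_preimage_self]
      exact Filter.univ_mem)
      x x.2 ((continuous_subtype_val.tendsto x).comp ht)
    refine ⟨⟨y, hy⟩, Subtype.ext hyx, ?_⟩
    rw [nhds_subtype, ← Filter.map_le_iff_le_comap]
    exact hle

section Support

variable {Y : TopCat.{u}}

/-- The support of a section `s` of an abelian presheaf over an open set `V`, as a subset of the
ambient space: the set of points of `V` at which the germ of `s` is nonzero. -/
def sectionSupport (F : TopCat.Presheaf AddCommGrpCat.{u} Y) {V : Opens Y} (s : F.obj (op V)) :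
    Set Y :=
  {y | ∃ hy : y ∈ V, F.germ V y hy s ≠ 0}

theorem not_mem_sectionSupport_iff {F : TopCat.Presheaf AddCommGrpCat.{u} Y} {V : Opens Y}
    {s : F.obj (op V)} {y : Y} (hy : y ∈ V) :
    y ∉ sectionSupport F s ↔ F.germ V y hy s = 0 := by
  simp [sectionSupport, hy]

/-- The support of a section over `V` is closed in `V`. -/
theorem mem_sectionSupport_of_ultrafilter {F : TopCat.Presheaf AddCommGrpCat.{u} Y} {V : Opens Y}
    {s : F.obj (op V)} {y : Y} (hy : y ∈ V) {𝒰 : Ultrafilter Y} (hle : (𝒰 : Filter Y) ≤ 𝓝 y)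
    (hs : sectionSupport F s ∈ 𝒰) : y ∈ sectionSupport F s := by
  by_contra hn
  rw [not_mem_sectionSupport_iff hy] at hn
  obtain ⟨W, hW, i, j, hij⟩ := F.germ_eq y hy hy s 0 (by rw [hn, map_zero])
  rw [map_zero] at hij
  have hW' : (W : Set Y) ∈ 𝒰 := hle (W.isOpen.mem_nhds hW)
  obtain ⟨z, ⟨hz, hzs⟩, hzW⟩ := 𝒰.nonempty_of_mem (Filter.inter_mem hs hW')
  apply hzs
  rw [← F.germ_res_apply i z hzW s, hij, map_zero]

theorem sectionSupport_zero (F : TopCat.Presheaf AddCommGrpCat.{u} Y) (V : Opens Y) :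
    sectionSupport F (0 : F.obj (op V)) = ∅ := by
  ext y
  simp [sectionSupport]

theorem sectionSupport_neg (F : TopCat.Presheaf AddCommGrpCat.{u} Y) {V : Opens Y}
    (s : F.obj (op V)) : sectionSupport F (-s) = sectionSupport F s := by
  ext y
  simp [sectionSupport]

theorem sectionSupport_add_subset (F : TopCat.Presheaf AddCommGrpCat.{u} Y) {V : Opens Y}
    (s t : F.obj (op V)) :
    sectionSupport F (s + t) ⊆ sectionSupport F s ∪ sectionSupport F t := by
  rintro y ⟨hy, h⟩
  by_contra hn
  rw [Set.mem_union, not_or, not_mem_sectionSupport_iff hy, not_mem_sectionSupport_iff hy] at hn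
  exact h (by rw [map_add, hn.1, hn.2, add_zero])

theorem sectionSupport_res (F : TopCat.Presheaf AddCommGrpCat.{u} Y) {V W : Opens Y}
    (i : W ⟶ V) (s : F.obj (op V)) :
    sectionSupport F (F.map i.op s) = sectionSupport F s ∩ W := by
  ext y
  constructor
  · rintro ⟨hy, h⟩
    rw [F.germ_res_apply i y hy s] at h
    exact ⟨⟨i.le hy, h⟩, hy⟩
  · rintro ⟨⟨hy, h⟩, hyW⟩
    exact ⟨hyW, by rwa [F.germ_res_apply i y hyW s]⟩

theorem sectionSupport_map_subset {F G : TopCat.Presheaf AddCommGrpCat.{u} Y} (φ : F ⟶ G)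
    {V : Opens Y} (s : F.obj (op V)) :
    sectionSupport G (φ.app (op V) s) ⊆ sectionSupport F s := by
  rintro y ⟨hy, h⟩
  refine ⟨hy, fun h0 ↦ h ?_⟩
  rw [← TopCat.Presheaf.stalkFunctor_map_germ_apply, h0]
  exact map_zero ((TopCat.Presheaf.stalkFunctor AddCommGrpCat.{u} y).map φ).hom

end Support

section ProperDirectImage

variable {Y X : TopCat.{u}} (f : Y ⟶ X)

/-- If a section has support contained in the union of two supports that are proper over `U`, then
its support is proper over `U`. -/
theorem mapsProperly_sectionSupport_of_subset
    {F G H : TopCat.Presheaf AddCommGrpCat.{u} Y} {U : Opens X}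
    {r : H.obj (op ((Opens.map f).obj U))} {s : F.obj (op ((Opens.map f).obj U))}
    {t : G.obj (op ((Opens.map f).obj U))}
    (h : sectionSupport H r ⊆ sectionSupport F s ∪ sectionSupport G t)
    (hs : MapsProperly f (sectionSupport F s) U) (ht : MapsProperly f (sectionSupport G t) U) :
    MapsProperly f (sectionSupport H r) U := by
  rw [mapsProperly_iff f.hom.continuous] at hs ht ⊢
  refine ⟨fun y hy ↦ (h hy).elim (fun h' ↦ hs.1 h') (fun h' ↦ ht.1 h'), fun 𝒰 hr x hx hlim ↦ ?_⟩
  have key : ∃ y, f y = x ∧ (𝒰 : Filter Y) ≤ 𝓝 y := by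
    rcases Ultrafilter.union_mem_iff.mp (Filter.mem_of_superset hr h) with h' | h'
    · obtain ⟨y, -, hy⟩ := hs.2 𝒰 h' x hx hlim
      exact ⟨y, hy⟩
    · obtain ⟨y, -, hy⟩ := ht.2 𝒰 h' x hx hlim
      exact ⟨y, hy⟩
  obtain ⟨y, hyx, hle⟩ := key
  have hyU : y ∈ (Opens.map f).obj U := by
    change f y ∈ U
    rw [hyx]
    exact hx
  exact ⟨y, mem_sectionSupport_of_ultrafilter hyU hle hr, hyx, hle⟩

/-- The group of sections `s ∈ F(f⁻¹(U))` such that `f : supp s → U` is proper. -/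
def properSections (F : TopCat.Presheaf AddCommGrpCat.{u} Y) (U : Opens X) :
    AddSubgroup (F.obj (op ((Opens.map f).obj U))) where
  carrier := {s | MapsProperly f (sectionSupport F s) U}
  zero_mem' := by
    rw [Set.mem_ofPred_eq, sectionSupport_zero, mapsProperly_iff f.hom.continuous]
    exact ⟨Set.mapsTo_empty _ _, fun 𝒰 h ↦ absurd h 𝒰.empty_notMem⟩
  add_mem' {s t} hs ht :=
    mapsProperly_sectionSupport_of_subset f (sectionSupport_add_subset F s t) hs ht
  neg_mem' {s} hs := by
    rw [Set.mem_ofPred_eq, sectionSupport_neg]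
    exact hs

theorem mem_properSections {F : TopCat.Presheaf AddCommGrpCat.{u} Y} {U : Opens X}
    {s : F.obj (op ((Opens.map f).obj U))} :
    s ∈ properSections f F U ↔ MapsProperly f (sectionSupport F s) U := Iff.rfl

theorem map_mem_properSections {F : TopCat.Presheaf AddCommGrpCat.{u} Y} {U W : Opens X}
    (i : W ⟶ U) {s : F.obj (op ((Opens.map f).obj U))} (hs : s ∈ properSections f F U) :
    F.map ((Opens.map f).map i).op s ∈ properSections f F W := by
  rw [mem_properSections, mapsProperly_iff f.hom.continuous] at hs ⊢
  rw [sectionSupport_res]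
  refine ⟨fun y hy ↦ hy.2, fun 𝒰 h x hx hlim ↦ ?_⟩
  obtain ⟨y, hy, hyx, hle⟩ := hs.2 𝒰 (Filter.mem_of_superset h Set.inter_subset_left) x
    (i.le hx) hlim
  refine ⟨y, ⟨hy, ?_⟩, hyx, hle⟩
  change f y ∈ W
  rw [hyx]
  exact hx

theorem app_mem_properSections {F G : TopCat.Presheaf AddCommGrpCat.{u} Y} (φ : F ⟶ G)
    {U : Opens X} {s : F.obj (op ((Opens.map f).obj U))} (hs : s ∈ properSections f F U) :
    φ.app (op ((Opens.map f).obj U)) s ∈ properSections f G U :=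
  mapsProperly_sectionSupport_of_subset f
    ((sectionSupport_map_subset φ s).trans (Set.subset_union_left (t := sectionSupport F s))) hs hs

/-- Properness of the support can be checked locally on the target. -/
theorem mem_properSections_of_cover {F : TopCat.Presheaf AddCommGrpCat.{u} Y} {ι : Type*}
    {U : ι → Opens X} {s : F.obj (op ((Opens.map f).obj (iSup U)))}
    (h : ∀ i, F.map ((Opens.map f).map (Opens.leSupr U i)).op s ∈ properSections f F (U i)) :
    s ∈ properSections f F (iSup U) := by
  rw [mem_properSections, mapsProperly_iff f.hom.continuous]
  refine ⟨fun y hy ↦ hy.1, fun 𝒰 hs x hx hlim ↦ ?_⟩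
  obtain ⟨i, hi⟩ := Opens.mem_iSup.mp hx
  have h' := h i
  rw [mem_properSections, mapsProperly_iff f.hom.continuous, sectionSupport_res] at h'
  obtain ⟨y, hy, hyx, hle⟩ := h'.2 𝒰
    (Filter.inter_mem hs (hlim ((U i).isOpen.mem_nhds hi))) x hi hlim
  exact ⟨y, hy.1, hyx, hle⟩

/-- The presheaf `U ↦ {s ∈ F(f⁻¹(U)) | f : supp s → U is proper}`, with the restriction maps
of `F`. -/
noncomputable def properDirectImagePresheaf (F : TopCat.Presheaf AddCommGrpCat.{u} Y) :
    TopCat.Presheaf AddCommGrpCat.{u} X where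
  obj U := AddCommGrpCat.of (properSections f F U.unop)
  map {U W} i := AddCommGrpCat.ofHom
    (((F.map ((Opens.map f).map i.unop).op).hom.comp (properSections f F U.unop).subtype).codRestrict
      (properSections f F W.unop) (fun s ↦ map_mem_properSections f i.unop s.2))
  map_id U := by
    ext s
    change F.map (𝟙 _) s.1 = s.1
    rw [F.map_id]
    rfl
  map_comp {U V W} i j := by
    ext s
    change F.map (((Opens.map f).map i.unop).op ≫ ((Opens.map f).map j.unop).op) s.1 = _
    rw [F.map_comp]
    rfl

theorem properDirectImagePresheaf_isSheaf (F : TopCat.Sheaf AddCommGrpCat.{u} Y) :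
    (properDirectImagePresheaf f F.obj).IsSheaf := by
  rw [TopCat.Presheaf.isSheaf_iff_isSheafUniqueGluing]
  intro ι U sf hsf
  have hcover : (Opens.map f).obj (iSup U) ≤ ⨆ i, (Opens.map f).obj (U i) := by
    intro y hy
    obtain ⟨i, hi⟩ := Opens.mem_iSup.mp (show f y ∈ iSup U from hy)
    exact Opens.mem_iSup.mpr ⟨i, hi⟩
  obtain ⟨s, hs, huniq⟩ := F.existsUnique_gluing' (fun i ↦ (Opens.map f).obj (U i))
    ((Opens.map f).obj (iSup U)) (fun i ↦ (Opens.map f).map (Opens.leSupr U i)) hcover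
    (fun i ↦ (sf i).1) (fun i j ↦ congrArg Subtype.val (hsf i j))
  refine ⟨⟨s, mem_properSections_of_cover f fun i ↦ ?_⟩, fun i ↦ Subtype.ext (hs i),
    fun t ht ↦ Subtype.ext (huniq t.1 fun i ↦ congrArg Subtype.val (ht i))⟩
  have := hs i
  dsimp only at this
  rw [this]
  exact (sf i).2

/-- The proper direct image functor `f_(!) : Sh(Y) ⥤ Sh(X)` on sheaves of abelian groups,
`(f_(!) F)(U) = {s ∈ F(f⁻¹(U)) | f : supp s → U is proper}`. -/
noncomputable def properDirectImage :
    TopCat.Sheaf AddCommGrpCat.{u} Y ⥤ TopCat.Sheaf AddCommGrpCat.{u} X where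
  obj F := ⟨properDirectImagePresheaf f F.obj, properDirectImagePresheaf_isSheaf f F⟩
  map {F G} φ := ⟨{
    app := fun U ↦ AddCommGrpCat.ofHom
      (((φ.hom.app (op ((Opens.map f).obj U.unop))).hom.comp
        (properSections f F.obj U.unop).subtype).codRestrict
          (properSections f G.obj U.unop) (fun s ↦ app_mem_properSections f φ.hom s.2))
    naturality := fun U W i ↦ by
      ext s
      apply Subtype.ext
      exact NatTrans.naturality_apply φ.hom ((Opens.map f).map i.unop).op s.1 }⟩
  map_id F := rfl
  map_comp φ ψ := rfl

instance : (properDirectImage f).Additive where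
  map_add := rfl

/-- The functor `f_(!)` has finite cohomological dimension: there is a natural number `d` such
that the right derived functors `R^p f_(!)` vanish for all `p > d`. -/
def HasFiniteCohomologicalDimension : Prop :=
  ∃ d : ℕ, ∀ p : ℕ, d < p → ∀ F : TopCat.Sheaf AddCommGrpCat.{u} Y,
    Limits.IsZero (((properDirectImage f).rightDerived p).obj F)

/-- The derived proper direct image functor `f_! = R f_(!) : D⁺(Y) ⥤ D⁺(X)` between the
bounded below derived categories of sheaves of abelian groups. -/
noncomputable def derivedProperDirectImage [HasDerivedCategory.{w₁} (TopCat.Sheaf AddCommGrpCat.{u} Y)]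
    [HasDerivedCategory.{w₂} (TopCat.Sheaf AddCommGrpCat.{u} X)] :
    DerivedCategory.Plus (TopCat.Sheaf AddCommGrpCat.{u} Y) ⥤
      DerivedCategory.Plus (TopCat.Sheaf AddCommGrpCat.{u} X) :=
  (properDirectImage f).rightDerivedFunctorPlus

end ProperDirectImage

/-!
A sheaf on `Y` is `f`-soft if its sections near a compact piece of a fiber extend, locally over `X`,
to a neighborhood of the fiber. Such sheaves form a class adapted to `f_(!)`: a section with proper
support lifts along an epimorphism with `f`-soft kernel, locally over `X`, to a section with proper
support. Let `B` be the sheaf of integer valued functions which locally have finitely many values.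
The functor `M ↦ M ⊗ B` is exact and preserves colimits, it has `f`-soft values since its sections
can be cut off by characteristic functions, and the constant functions embed `M` into `M ⊗ B`.
Iterating this embedding gives a functorial resolution of every sheaf, which is truncated at a fixed
length: as `f_(!)` has finite cohomological dimension, the last term is acyclic too. Hence `f_!` is
computed on complexes by applying `f_(!)` to this resolution. The functor on complexes obtained in
this way preserves colimits, because `f_(!)` preserves coproducts and epimorphisms with `f`-soft
kernel, so it has a right adjoint by the adjoint functor theorem. The resolution has bounded length,
so the right adjoint preserves bounded below complexes, and deriving it by injective resolutions
yields `f^!`.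
-/

section ExtensionAcyclic

open Limits

variable {A B : Type*} [Category* A] [Category* B] [Abelian A]

lemma shortExact_pushout_inr {S : ShortComplex A} (hS : S.ShortExact) {X : A} (i : S.X₁ ⟶ X) :
    (ShortComplex.mk (pushout.inr S.f i) (pushout.desc S.g 0 (by simp))
      (pushout.inr_desc _ _ _)).ShortExact := by
  have := hS.mono_f
  have := hS.epi_g
  have : Epi (pushout.desc S.g (0 : X ⟶ S.X₃) (by simp) : pushout S.f i ⟶ S.X₃) :=
    epi_of_epi_fac (pushout.inl_desc _ _ _)
  refine ShortComplex.ShortExact.mk' (ShortComplex.exact_of_g_is_cokernel _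
    (CokernelCofork.IsColimit.ofπ' _ _ fun t (ht : pushout.inr S.f i ≫ t = 0) ↦ ?_))
    inferInstance this
  have ht' : S.f ≫ pushout.inl S.f i ≫ t = 0 := by
    rw [pushout.condition_assoc, ht, comp_zero]
  refine ⟨hS.exact.desc _ ht', pushout.hom_ext ?_ ?_⟩
  · rw [pushout.inl_desc_assoc]
    exact hS.exact.g_desc _ ht'
  · rw [pushout.inr_desc_assoc, zero_comp, ht]

lemma shortExact_pushout_inl {S : ShortComplex A} (hS : S.ShortExact) {X : A} (i : S.X₁ ⟶ X) :
    (ShortComplex.mk (pushout.inl i S.f) (pushout.desc 0 S.g (by simp))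
      (pushout.inl_desc _ _ _)).ShortExact :=
  ShortComplex.shortExact_of_iso
    (S₁ := ShortComplex.mk (pushout.inr S.f i) (pushout.desc S.g 0 (by simp))
      (pushout.inr_desc _ _ _))
    (ShortComplex.isoMk (Iso.refl _) (pushoutSymmetry S.f i) (Iso.refl _) (by simp)
      (pushout.hom_ext (by simp [pushout.inl_desc, pushout.inr_desc])
        (by simp [pushout.inl_desc, pushout.inr_desc])))
    (shortExact_pushout_inr hS i)

lemma shortExact_comp_pushout_inl {S : ShortComplex A} (hS : S.ShortExact) {X : A}
    (i : S.X₂ ⟶ X) [Mono i] :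
    (ShortComplex.mk (S.f ≫ i) (pushout.inl i S.g)
      (by rw [Category.assoc, pushout.condition, S.zero_assoc, zero_comp])).ShortExact := by
  have := hS.mono_f
  have := hS.epi_g
  refine ShortComplex.ShortExact.mk' (ShortComplex.exact_of_g_is_cokernel _
    (CokernelCofork.IsColimit.ofπ' _ _ fun t (ht : (S.f ≫ i) ≫ t = 0) ↦ ?_))
    (mono_comp _ _) inferInstance
  have ht' : S.f ≫ i ≫ t = 0 := by rwa [← Category.assoc]
  exact ⟨pushout.desc t (hS.exact.desc _ ht') (hS.exact.g_desc _ ht').symm,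
    pushout.inl_desc _ _ _⟩

lemma shortExact_injective_ι [EnoughInjectives A] (M : A) :
    (ShortComplex.mk (Injective.ι M) _ (cokernel.condition _)).ShortExact :=
  .mk' (ShortComplex.exact_cokernel _) inferInstance inferInstance

lemma epi_comp_of_exact {X P N Y Z : A} {b : X ⟶ P} {q : P ⟶ N} {w : b ≫ q = 0}
    (h : (ShortComplex.mk b q w).Exact) {a : Y ⟶ P} {r : P ⟶ Z} (har : a ≫ r = 0)
    [Epi (a ≫ q)] [Epi r] : Epi (b ≫ r) := by
  have : Epi q := epi_of_epi a q
  refine Preadditive.epi_of_cancel_zero _ fun t ht ↦ ?_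
  have hb : b ≫ r ≫ t = 0 := by rwa [← Category.assoc]
  have hu : q ≫ h.desc (r ≫ t) hb = r ≫ t := h.g_desc _ hb
  have hzero : h.desc (r ≫ t) hb = 0 := by
    rw [← cancel_epi (a ≫ q), Category.assoc, hu, reassoc_of% har, zero_comp, comp_zero]
  rw [← cancel_epi r, ← hu, hzero, comp_zero, comp_zero]

lemma epi_of_exact_of_comp_mono {X Y W Z : A} {f : X ⟶ Y} {g : Y ⟶ W} {w : f ≫ g = 0}
    (h : (ShortComplex.mk f g w).Exact) {e : X ⟶ Z} {k : Z ⟶ Y} [Mono k] (he : e ≫ k = f)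
    (hk : k ≫ g = 0) : Epi e := by
  rw [epi_iff_surjective_up_to_refinements]
  intro T y
  obtain ⟨T', π, hπ, x, hx⟩ := h.exact_up_to_refinements (y ≫ k) (by simp [hk])
  exact ⟨T', π, hπ, x, by simpa [← cancel_mono k, he] using hx⟩

lemma shortExact_kernel_lift {X Y W Z : A} {f : X ⟶ Y} {g : Y ⟶ W} {w : f ≫ g = 0}
    (h : (ShortComplex.mk f g w).Exact) {k : Z ⟶ X} [Mono k] {w' : k ≫ f = 0}
    (hk : (ShortComplex.mk k f w').Exact) :
    (ShortComplex.mk k (kernel.lift g f w) (by simp [← cancel_mono (kernel.ι g), w'])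
      ).ShortExact := by
  refine .mk' ?_ ‹_› (epi_of_exact_of_comp_mono h (kernel.lift_ι _ _ _) (kernel.condition _))
  let φ : ShortComplex.mk k (kernel.lift g f w) (by simp [← cancel_mono (kernel.ι g), w']) ⟶
      ShortComplex.mk k f w' :=
    { τ₁ := 𝟙 _, τ₂ := 𝟙 _, τ₃ := kernel.ι g }
  have : Epi φ.τ₁ := inferInstanceAs (Epi (𝟙 _))
  have : IsIso φ.τ₂ := inferInstanceAs (IsIso (𝟙 _))
  have : Mono φ.τ₃ := inferInstanceAs (Mono (kernel.ι g))
  exact (ShortComplex.exact_iff_of_epi_of_isIso_of_mono φ).2 hk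

variable (F : A ⥤ B)

/-- `F` preserves the exactness of all short exact sequences with first term `M`. For a left
exact functor this is the vanishing of `R¹F M`; this formulation avoids the long exact sequence of
derived functors. -/
def PreservesEpiOfExtension (M : A) : Prop :=
  ∀ ⦃X Y : A⦄ (f : M ⟶ X) (g : X ⟶ Y) (w : f ≫ g = 0),
    (ShortComplex.mk f g w).ShortExact → Epi (F.map g)

/-- A class of objects which is adapted to computing the right derived functors of a left exact
functor `F`: it contains the injective objects, is stable under quotients by its members, and `F`
preserves short exact sequences whose first term belongs to it. -/
structure IsAdaptedClass (P : ObjectProperty A) : Prop where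
  injective (I : A) [Injective I] : P I
  quotient (S : ShortComplex A) (hS : S.ShortExact) (h₁ : P S.X₁) (h₂ : P S.X₂) : P S.X₃
  epi_map (S : ShortComplex A) (hS : S.ShortExact) (h₁ : P S.X₁) : Epi (F.map S.g)

/-- `M` has a coresolution of length `n` by objects in `P` up to an object on which the first
derived functor of `F` vanishes. -/
def HasAdaptedDimensionLE (P : ObjectProperty A) : ℕ → A → Prop
  | 0, M => PreservesEpiOfExtension F M
  | n + 1, M => ∃ (S N : A) (f : M ⟶ S) (g : S ⟶ N) (w : f ≫ g = 0),
      (ShortComplex.mk f g w).ShortExact ∧ P S ∧ HasAdaptedDimensionLE P n N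

variable {F} {P : ObjectProperty A}

lemma IsAdaptedClass.preservesEpiOfExtension (hP : IsAdaptedClass F P) {S : A} (hS : P S) :
    PreservesEpiOfExtension F S :=
  fun _ _ _ _ _ h ↦ hP.epi_map _ h hS

lemma hasAdaptedDimensionLE_X₃_of_iff {n : ℕ}
    (hn : ∀ {S : ShortComplex A}, S.ShortExact → P S.X₁ →
      (HasAdaptedDimensionLE F P n S.X₂ ↔ HasAdaptedDimensionLE F P n S.X₃))
    {S : ShortComplex A} (hS : S.ShortExact) (h₂ : P S.X₂)
    (h : HasAdaptedDimensionLE F P (n + 1) S.X₁) : HasAdaptedDimensionLE F P n S.X₃ := by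
  obtain ⟨S', N', f', g', w', hS', hPS', hN'⟩ := h
  have hN : HasAdaptedDimensionLE F P n (pushout S.f f') :=
    (hn (shortExact_pushout_inl hS' S.f) h₂).2 hN'
  exact (hn (shortExact_pushout_inr hS f') hPS').1 hN

variable [Abelian B]

lemma PreservesEpiOfExtension.of_shortExact [F.PreservesZeroMorphisms] [PreservesFiniteLimits F]
    {S : ShortComplex A} (hS : S.ShortExact) (h : PreservesEpiOfExtension F S.X₂)
    [hg : Epi (F.map S.g)] : PreservesEpiOfExtension F S.X₁ := by
  intro X Y i p w hp
  let r : pushout S.f i ⟶ Y := pushout.desc 0 p (by rw [w, comp_zero])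
  have : Epi (F.map r) := h _ _ _ (shortExact_pushout_inl hp S.f)
  have hinr := shortExact_pushout_inr hS i
  have := hinr.mono_f
  have hex := hinr.exact.map_of_mono_of_preservesKernel F inferInstance inferInstance
  have : Epi (F.map (pushout.inl S.f i) ≫ F.map (pushout.desc S.g (0 : X ⟶ _) (by simp))) := by
    rwa [← F.map_comp, pushout.inl_desc]
  have hepi := epi_comp_of_exact hex (a := F.map (pushout.inl S.f i)) (r := F.map r)
    (by rw [← F.map_comp, pushout.inl_desc, F.map_zero])
  rwa [← F.map_comp, pushout.inr_desc] at hepi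

namespace IsAdaptedClass

variable (hP : IsAdaptedClass F P)

include hP

variable [F.PreservesZeroMorphisms] [PreservesFiniteLimits F]

section EnoughInjectives

variable [EnoughInjectives A]

lemma preservesEpiOfExtension_iff {S : ShortComplex A} (hS : S.ShortExact) (h₁ : P S.X₁) :
    PreservesEpiOfExtension F S.X₂ ↔ PreservesEpiOfExtension F S.X₃ := by
  let I := Injective.under S.X₂
  let C := pushout (Injective.ι S.X₂) S.g
  let r : C ⟶ cokernel (Injective.ι S.X₂) := pushout.desc (cokernel.π _) 0 (by simp)
  have hI := shortExact_injective_ι S.X₂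
  have hC := shortExact_comp_pushout_inl hS (Injective.ι S.X₂)
  have hN := shortExact_pushout_inr hI S.g
  have hPC : P C := hP.quotient _ hC h₁ (hP.injective I)
  have hepi : Epi (F.map (pushout.inl (Injective.ι S.X₂) S.g)) := hP.epi_map _ hC h₁
  have hfac : F.map (pushout.inl (Injective.ι S.X₂) S.g) ≫ F.map r = F.map (cokernel.π _) := by
    rw [← F.map_comp, pushout.inl_desc]
  constructor
  · intro h
    have := h _ _ _ hI
    have : Epi (F.map r) := epi_of_epi_fac hfac
    exact .of_shortExact hN (hP.preservesEpiOfExtension hPC)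
  · intro h
    have : Epi (F.map r) := h _ _ _ hN
    have : Epi (F.map (cokernel.π (Injective.ι S.X₂))) := hfac ▸ epi_comp _ _
    exact .of_shortExact hI (hP.preservesEpiOfExtension (hP.injective I))

lemma hasAdaptedDimensionLE_iff (n : ℕ) {S : ShortComplex A} (hS : S.ShortExact) (h₁ : P S.X₁) :
    HasAdaptedDimensionLE F P n S.X₂ ↔ HasAdaptedDimensionLE F P n S.X₃ := by
  induction n generalizing S with
  | zero => exact hP.preservesEpiOfExtension_iff hS h₁
  | succ n hn =>
    constructor
    · rintro ⟨S', N', f', g', w', hS', hPS', hN'⟩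
      have := hS'.mono_f
      exact ⟨_, _, _, _, _, shortExact_pushout_inr hS' S.g,
        hP.quotient _ (shortExact_comp_pushout_inl hS f') h₁ hPS', hN'⟩
    · intro h
      have hI := shortExact_injective_ι S.X₂
      refine ⟨_, _, _, _, _, hI, hP.injective _, hasAdaptedDimensionLE_X₃_of_iff hn
        (shortExact_pushout_inr hI S.g) ?_ h⟩
      exact hP.quotient _ (shortExact_comp_pushout_inl hS (Injective.ι S.X₂)) h₁ (hP.injective _)

lemma hasAdaptedDimensionLE_of_succ {n : ℕ} {S : ShortComplex A} (hS : S.ShortExact)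
    (h₂ : P S.X₂) (h : HasAdaptedDimensionLE F P (n + 1) S.X₁) :
    HasAdaptedDimensionLE F P n S.X₃ :=
  hasAdaptedDimensionLE_X₃_of_iff (hP.hasAdaptedDimensionLE_iff n) hS h₂ h

end EnoughInjectives

lemma hasAdaptedDimensionLE_of_injectiveResolution {M : A} (I : InjectiveResolution M) {d : ℕ}
    (h : ((F.mapHomologicalComplex _).obj I.cocomplex).ExactAt (d + 1)) (j n : ℕ) (hn : n + j = d)
    {Z : A} (k : Z ⟶ I.cocomplex.X n) [Mono k] (w : k ≫ I.cocomplex.d n (n + 1) = 0)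
    (hk : (ShortComplex.mk _ _ w).Exact) : HasAdaptedDimensionLE F P j Z := by
  have hZ := shortExact_kernel_lift (I.exact_succ n) hk
  induction j generalizing n Z with
  | zero =>
    obtain rfl : n = d := hn
    have hex : (ShortComplex.mk (F.map (I.cocomplex.d n (n + 1)))
        (F.map (I.cocomplex.d (n + 1) (n + 2)))
        (by rw [← F.map_comp, I.cocomplex.d_comp_d, F.map_zero])).Exact := by
      rwa [HomologicalComplex.exactAt_iff' _ n (n + 1) (n + 2) (by simp) (by simp)] at h
    have := epi_of_exact_of_comp_mono hex
      (e := F.map (kernel.lift _ (I.cocomplex.d n (n + 1)) (I.cocomplex.d_comp_d _ _ _)))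
      (k := F.map (kernel.ι _)) (by rw [← F.map_comp, kernel.lift_ι])
      (by rw [← F.map_comp, kernel.condition, F.map_zero])
    exact .of_shortExact hZ (hP.preservesEpiOfExtension (hP.injective _))
  | succ j hj =>
    exact ⟨_, _, _, _, _, hZ, hP.injective _, hj (n + 1) (by lia) (kernel.ι _)
      (kernel.condition _) (ShortComplex.exact_kernel _)
      (shortExact_kernel_lift (I.exact_succ (n + 1)) (ShortComplex.exact_kernel _))⟩

lemma hasAdaptedDimensionLE_of_isZero_rightDerived [HasInjectiveResolutions A] [F.Additive]
    {d : ℕ} {M : A} (h : IsZero ((F.rightDerived (d + 1)).obj M)) :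
    HasAdaptedDimensionLE F P d M := by
  let I : InjectiveResolution M := HasInjectiveResolution.out.some
  let k : M ⟶ I.cocomplex.X 0 := I.ι.f 0
  have : Mono k := mono_of_isLimit_fork I.isLimitKernelFork
  refine hP.hasAdaptedDimensionLE_of_injectiveResolution I (d := d) ?_ d 0 (zero_add d) k
    I.ι_f_zero_comp_complex_d (ShortComplex.exact_of_f_is_kernel _ I.isLimitKernelFork)
  rw [HomologicalComplex.exactAt_iff_isZero_homology]
  exact h.of_iso (I.isoRightDerivedObj F (d + 1)).symm

end IsAdaptedClass

end ExtensionAcyclic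

section MappingCocone

open Limits HomologicalComplex CochainComplex HomComplex

variable {C : Type*} [Category* C] [Abelian C]

lemma quasiIso_of_acyclic_X₃ {S : ShortComplex (CochainComplex C ℤ)} (hS : S.ShortExact)
    (h : S.X₃.Acyclic) : QuasiIso S.f := by
  have hz (m : ℤ) : IsZero (S.X₃.homology m) := (exactAt_iff_isZero_homology _ _).1 (h m)
  rw [quasiIso_iff]
  intro n
  rw [quasiIsoAt_iff_isIso_homologyMap]
  have : Mono (homologyMap S.f n) :=
    (hS.homology_exact₁ (n - 1) n (by simp)).mono_g ((hz _).eq_of_src _ _)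
  have : Epi (homologyMap S.f n) := (hS.homology_exact₂ n).epi_f ((hz _).eq_of_tgt _ _)
  exact isIso_of_mono_of_epi _

section Map

variable {K₁ L₁ K₂ L₂ : CochainComplex C ℤ} (φ₁ : K₁ ⟶ L₁) (φ₂ : K₂ ⟶ L₂) (a : K₁ ⟶ K₂)
  (b : L₁ ⟶ L₂) (comm : φ₁ ≫ b = a ≫ φ₂)

lemma quasiIso_mappingCone_map [QuasiIso a] [QuasiIso b] :
    QuasiIso (mappingCone.map φ₁ φ₂ a b comm) := by
  let := HasDerivedCategory.standard C
  rw [← DerivedCategory.isIso_Q_map_iff_quasiIso]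
  exact Pretriangulated.isIso₃_of_isIso₁₂
    (DerivedCategory.Q.mapTriangle.map (mappingCone.triangleMap φ₁ φ₂ a b comm))
    (DerivedCategory.mappingCone_triangle_distinguished φ₁)
    (DerivedCategory.mappingCone_triangle_distinguished φ₂)
    ((DerivedCategory.isIso_Q_map_iff_quasiIso _ a).2 inferInstance)
    ((DerivedCategory.isIso_Q_map_iff_quasiIso _ b).2 inferInstance)

/-- The morphism between mapping cocones induced by a commutative square of cochain complexes. -/
noncomputable def mappingCoconeMap : mappingCocone φ₁ ⟶ mappingCocone φ₂ :=
  (mappingCone.map φ₁ φ₂ a b comm)⟦(-1 : ℤ)⟧'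

lemma quasiIso_mappingCoconeMap [QuasiIso a] [QuasiIso b] :
    QuasiIso (mappingCoconeMap φ₁ φ₂ a b comm) :=
  (quasiIso_shift_iff _ _).2 (quasiIso_mappingCone_map φ₁ φ₂ a b comm)

lemma mappingCocone_fst_f {K L : CochainComplex C ℤ} (φ : K ⟶ L) (n : ℤ) :
    (mappingCocone.fst φ).f n = (mappingCone.fst φ).1.v (n + -1) n (by lia) := by
  refine (congrArg Neg.neg (Cochain.leftShift_v (mappingCone.fst φ).1 (-1) 0 (add_neg_cancel 1)
    n n (add_zero n) (n + -1) (by lia))).trans ?_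
  simp only [Int.reduceNeg, shiftFunctor_obj_X', mul_zero, Int.reduceSub, mul_neg, neg_mul,
    one_mul, neg_neg, ne_eq, OfNat.ofNat_ne_zero, not_false_eq_true, EuclideanDomain.div_self,
    zero_add, Int.negOnePow_one, shiftFunctorObjXIso, XIsoOfEq_rfl, Iso.refl_hom, Units.neg_smul,
    one_smul]
  exact (neg_neg _).trans (Category.id_comp _)

lemma mappingCocone_snd_v {K L : CochainComplex C ℤ} (φ : K ⟶ L) (n : ℤ) :
    (mappingCocone.snd φ).v n (n + -1) rfl = (mappingCone.snd φ).v (n + -1) (n + -1) (by lia) := by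
  refine (Cochain.leftShift_v (mappingCone.snd φ) (-1) (-1) (zero_add _) n (n + -1) rfl (n + -1)
    (by lia)).trans ?_
  simp only [Int.reduceNeg, shiftFunctor_obj_X', mul_neg, mul_one, neg_neg, Int.reduceSub,
    neg_mul, one_mul, ne_eq, OfNat.ofNat_ne_zero, not_false_eq_true, EuclideanDomain.div_self,
    Int.reduceAdd, Int.negOnePow_even 2 ⟨1, rfl⟩, shiftFunctorObjXIso, XIsoOfEq_rfl,
    Iso.refl_hom, one_smul]
  exact Category.id_comp _

lemma mappingCocone_hom_ext {K L : CochainComplex C ℤ} (φ : K ⟶ L) {n m : ℤ} (h : n + -1 = m)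
    {T : C} {x y : T ⟶ (mappingCocone φ).X n}
    (h₁ : x ≫ (mappingCocone.fst φ).f n = y ≫ (mappingCocone.fst φ).f n)
    (h₂ : x ≫ (mappingCocone.snd φ).v n m h = y ≫ (mappingCocone.snd φ).v n m h) : x = y := by
  rw [← Category.comp_id x, ← Category.comp_id y, ← mappingCocone.id_X φ n m h,
    Preadditive.comp_add, Preadditive.comp_add, reassoc_of% h₁, reassoc_of% h₂]

@[simp]
lemma mappingCoconeMap_f_fst_f (n : ℤ) :
    (mappingCoconeMap φ₁ φ₂ a b comm).f n ≫ (mappingCocone.fst φ₂).f n =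
      (mappingCocone.fst φ₁).f n ≫ a.f n := by
  have : (mappingCone.map φ₁ φ₂ a b comm).f (n + -1) ≫
      (mappingCone.fst φ₂).1.v (n + -1) n (by lia) =
      (mappingCone.fst φ₁).1.v (n + -1) n (by lia) ≫ a.f n := by
    rw [mappingCone.ext_from_iff φ₁ n (n + -1) (by lia)]
    simp [mappingCone.map]
  rw [mappingCocone_fst_f, mappingCocone_fst_f]
  exact this

@[simp]
lemma mappingCoconeMap_f_snd_v (n m : ℤ) (h : n + -1 = m) :
    (mappingCoconeMap φ₁ φ₂ a b comm).f n ≫ (mappingCocone.snd φ₂).v n m h =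
      (mappingCocone.snd φ₁).v n m h ≫ b.f m := by
  subst h
  have : (mappingCone.map φ₁ φ₂ a b comm).f (n + -1) ≫
      (mappingCone.snd φ₂).v (n + -1) (n + -1) (by lia) =
      (mappingCone.snd φ₁).v (n + -1) (n + -1) (by lia) ≫ b.f (n + -1) := by
    rw [mappingCone.ext_from_iff φ₁ n (n + -1) (by lia)]
    simp [mappingCone.map]
  rw [mappingCocone_snd_v, mappingCocone_snd_v]
  exact this

@[simp]
lemma mappingCoconeMap_f_fst_f_assoc (n : ℤ) {Z : C} (z : K₂.X n ⟶ Z) :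
    (mappingCoconeMap φ₁ φ₂ a b comm).f n ≫ (mappingCocone.fst φ₂).f n ≫ z =
      (mappingCocone.fst φ₁).f n ≫ a.f n ≫ z := by
  rw [← Category.assoc, mappingCoconeMap_f_fst_f, Category.assoc]

@[simp]
lemma mappingCoconeMap_f_snd_v_assoc (n m : ℤ) (h : n + -1 = m) {Z : C} (z : L₂.X m ⟶ Z) :
    (mappingCoconeMap φ₁ φ₂ a b comm).f n ≫ (mappingCocone.snd φ₂).v n m h ≫ z =
      (mappingCocone.snd φ₁).v n m h ≫ b.f m ≫ z := by
  rw [← Category.assoc, mappingCoconeMap_f_snd_v, Category.assoc]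

lemma inl_v_mappingCoconeMap_f (n : ℤ) :
    (mappingCocone.inl φ₁).v n n (add_zero n) ≫ (mappingCoconeMap φ₁ φ₂ a b comm).f n =
      a.f n ≫ (mappingCocone.inl φ₂).v n n (add_zero n) :=
  mappingCocone_hom_ext φ₂ rfl (by simp) (by simp)

lemma inr_v_mappingCoconeMap_f (m n : ℤ) (h : m + 1 = n) :
    (mappingCocone.inr φ₁).1.v m n h ≫ (mappingCoconeMap φ₁ φ₂ a b comm).f n =
      b.f m ≫ (mappingCocone.inr φ₂).1.v m n h :=
  mappingCocone_hom_ext φ₂ (m := m) (by lia) (by simp) (by simp)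

lemma mono_mappingCoconeMap [Mono a] [Mono b] : Mono (mappingCoconeMap φ₁ φ₂ a b comm) := by
  refine mono_of_mono_f _ fun n ↦ ⟨fun {T} x y h ↦ mappingCocone_hom_ext φ₁ rfl ?_ ?_⟩
  · rw [← cancel_mono (a.f n)]
    simpa using h =≫ (mappingCocone.fst φ₂).f n
  · rw [← cancel_mono (b.f _)]
    simpa using h =≫ (mappingCocone.snd φ₂).v n _ rfl

lemma epi_mappingCoconeMap [Epi a] [Epi b] : Epi (mappingCoconeMap φ₁ φ₂ a b comm) := by
  refine epi_of_epi_f _ fun n ↦ Preadditive.epi_of_cancel_zero _ fun {T} t ht ↦ ?_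
  have h₁ : (mappingCocone.inl φ₂).v n n (add_zero n) ≫ t = 0 := by
    rw [← cancel_epi (a.f n), ← Category.assoc, ← inl_v_mappingCoconeMap_f φ₁ φ₂ a b comm,
      Category.assoc, ht, comp_zero, comp_zero]
  have h₂ : (mappingCocone.inr φ₂).1.v (n + -1) n (by lia) ≫ t = 0 := by
    rw [← cancel_epi (b.f (n + -1)), ← Category.assoc,
      ← inr_v_mappingCoconeMap_f φ₁ φ₂ a b comm, Category.assoc, ht, comp_zero, comp_zero]
  rw [← Category.id_comp t, ← mappingCocone.id_X φ₂ n (n + -1) rfl, Preadditive.add_comp,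
    Category.assoc, Category.assoc, h₁, h₂, comp_zero, comp_zero, add_zero]

end Map

lemma acyclic_mappingCocone {K L : CochainComplex C ℤ} (φ : K ⟶ L) [QuasiIso φ] :
    (mappingCocone φ).Acyclic := by
  have hφ := quasiIso_mappingCoconeMap φ (𝟙 L) φ (𝟙 L) rfl
  intro n
  rw [exactAt_iff_of_quasiIsoAt (mappingCoconeMap φ (𝟙 L) φ (𝟙 L) rfl) n,
    exactAt_iff_isZero_homology]
  refine IsZero.of_iso ?_
    (((homologyFunctor C (.up ℤ) 0).shiftIso (-1) n (-1 + n) rfl).app (mappingCone (𝟙 L)))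
  change IsZero ((mappingCone (𝟙 L)).homology (-1 + n))
  rw [IsZero.iff_id_eq_zero, ← homologyMap_id, (mappingCone.homotopyToZeroOfId L).homologyMap_eq,
    homologyMap_zero]

section Lift

variable {S : ShortComplex (CochainComplex C ℤ)} {N : CochainComplex C ℤ} (γ : S.X₃ ⟶ N)

/-- The morphism from the kernel of `g` to the mapping cocone of `g ≫ γ`. -/
noncomputable def liftMappingCocone : S.X₁ ⟶ mappingCocone (S.g ≫ γ) :=
  mappingCocone.lift (S.g ≫ γ) S.f 0 (by simp)

@[simp]
lemma liftMappingCocone_f_fst_f (n : ℤ) :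
    (liftMappingCocone γ).f n ≫ (mappingCocone.fst (S.g ≫ γ)).f n = S.f.f n := by
  simp [liftMappingCocone]

@[simp]
lemma liftMappingCocone_f_snd_v (n m : ℤ) (h : n + -1 = m) :
    (liftMappingCocone γ).f n ≫ (mappingCocone.snd (S.g ≫ γ)).v n m h = 0 := by
  simp [liftMappingCocone]

lemma liftMappingCocone_comp_map :
    liftMappingCocone γ ≫ mappingCoconeMap (S.g ≫ γ) γ S.g (𝟙 N) (by simp) = 0 := by
  ext n
  have hn : S.f.f n ≫ S.g.f n = 0 := by rw [← comp_f, S.zero, zero_f]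
  refine mappingCocone_hom_ext _ rfl ?_ (by simp [liftMappingCocone])
  rw [comp_f, Category.assoc, mappingCoconeMap_f_fst_f, ← Category.assoc,
    liftMappingCocone_f_fst_f, hn, zero_f, zero_comp]

lemma shortExact_liftMappingCocone_f (hS : S.ShortExact) (n : ℤ) :
    (ShortComplex.mk ((liftMappingCocone γ).f n)
      ((mappingCoconeMap (S.g ≫ γ) γ S.g (𝟙 N) (by simp)).f n)
      (congr_hom (liftMappingCocone_comp_map γ) n)).ShortExact := by
  have := hS.epi_g
  have hn : (ShortComplex.mk (S.f.f n) (S.g.f n) (congr_hom S.zero n)).ShortExact :=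
    hS.map_of_exact (HomologicalComplex.eval C (.up ℤ) n)
  have : Mono (S.f.f n) := hn.mono_f
  have hmono : Mono ((liftMappingCocone γ).f n) := mono_of_mono_fac (liftMappingCocone_f_fst_f γ n)
  have := epi_mappingCoconeMap (S.g ≫ γ) γ S.g (𝟙 N) (by simp)
  refine .mk' (ShortComplex.exact_of_f_is_kernel _ (KernelFork.IsLimit.ofι' _ _
    fun {T} (x : T ⟶ (mappingCocone (S.g ≫ γ)).X n) (hx : x ≫ _ = 0) ↦ ?_)) hmono inferInstance
  have h₁ : (x ≫ (mappingCocone.fst (S.g ≫ γ)).f n) ≫ S.g.f n = 0 := by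
    simpa using hx =≫ (mappingCocone.fst γ).f n
  have h₂ : x ≫ (mappingCocone.snd (S.g ≫ γ)).v n _ rfl = 0 := by
    simpa using hx =≫ (mappingCocone.snd γ).v n _ rfl
  refine ⟨hn.exact.lift _ h₁, mappingCocone_hom_ext _ rfl ?_ ?_⟩
  · simpa using hn.exact.lift_f _ h₁
  · simp [h₂]

lemma liftMappingCocone_naturality {S₁ S₂ : ShortComplex (CochainComplex C ℤ)}
    {N₁ N₂ : CochainComplex C ℤ} {γ₁ : S₁.X₃ ⟶ N₁} {γ₂ : S₂.X₃ ⟶ N₂} (f : S₁ ⟶ S₂)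
    (b : N₁ ⟶ N₂) (comm : (S₁.g ≫ γ₁) ≫ b = f.τ₂ ≫ S₂.g ≫ γ₂) :
    f.τ₁ ≫ liftMappingCocone γ₂ = liftMappingCocone γ₁ ≫ mappingCoconeMap _ _ f.τ₂ b comm := by
  ext n
  have hn : f.τ₁.f n ≫ S₂.f.f n = S₁.f.f n ≫ f.τ₂.f n := congr_hom f.comm₁₂ n
  refine mappingCocone_hom_ext _ rfl ?_ ?_
  · rw [comp_f, comp_f, Category.assoc, Category.assoc, liftMappingCocone_f_fst_f,
      mappingCoconeMap_f_fst_f, ← Category.assoc, liftMappingCocone_f_fst_f, hn]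
  · rw [comp_f, comp_f, Category.assoc, Category.assoc, liftMappingCocone_f_snd_v,
      mappingCoconeMap_f_snd_v, ← Category.assoc, liftMappingCocone_f_snd_v, comp_zero, zero_comp]

lemma quasiIso_liftMappingCocone (hS : S.ShortExact) (_ : QuasiIso γ) :
    QuasiIso (liftMappingCocone γ) :=
  quasiIso_of_acyclic_X₃ (S := .mk _ _ (liftMappingCocone_comp_map γ))
    (shortExact_of_degreewise_shortExact _ (shortExact_liftMappingCocone_f γ hS))
    (acyclic_mappingCocone γ)

end Lift

/-- The functor which sends `X` to the mapping cocone of `τ.app X`, for a natural transformation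
`τ` between functors to cochain complexes. -/
noncomputable def mappingCoconeFunctor {D : Type*} [Category* D] {Φ Ψ : D ⥤ CochainComplex C ℤ}
    (τ : Φ ⟶ Ψ) : D ⥤ CochainComplex C ℤ where
  obj X := mappingCocone (τ.app X)
  map f := mappingCoconeMap _ _ (Φ.map f) (Ψ.map f) (by simp)
  map_id X := by
    ext n
    exact mappingCocone_hom_ext _ rfl (by simp) (by simp)
  map_comp f g := by
    ext n
    exact mappingCocone_hom_ext _ rfl (by simp) (by simp)

/-- The natural version of `liftMappingCocone`. -/
noncomputable def liftMappingCoconeFunctor {D : Type*} [Category* D]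
    (S : ShortComplex (D ⥤ CochainComplex C ℤ)) {Ψ : D ⥤ CochainComplex C ℤ} (γ : S.X₃ ⟶ Ψ) :
    S.X₁ ⟶ mappingCoconeFunctor (S.g ≫ γ) where
  app X := liftMappingCocone (S := S.map ((evaluation _ _).obj X)) (γ.app X)
  naturality _ _ f := liftMappingCocone_naturality (S.mapNatTrans ((evaluation _ _).map f))
    (Ψ.map f) ((S.g ≫ γ).naturality f).symm

end MappingCocone

section IsCocontinuousExact

open Limits HomologicalComplex CochainComplex

lemma preservesColimitsOfShape_of_isColimit {J K D E : Type*} [Category* J] [Category* K]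
    [Category* D] [Category* E] [HasColimitsOfShape K E] {diag : K ⥤ D ⥤ E} {c : Cocone diag}
    (hc : IsColimit c) (h : ∀ k, PreservesColimitsOfShape J (diag.obj k)) :
    PreservesColimitsOfShape J c.pt := by
  have : PreservesColimitsOfShape J diag.flip := ⟨⟨fun hs ↦
    ⟨evaluationJointlyReflectsColimits _ fun k ↦ isColimitOfPreserves (diag.obj k) hs⟩⟩⟩
  let e : diag.flip ⋙ colim ≅ c.pt := NatIso.ofComponents fun X ↦
    (colimit.isColimit (diag.flip.obj X)).coconePointUniqueUpToIso
      (isColimitOfPreserves ((evaluation _ _).obj X) hc)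
  exact preservesColimitsOfShape_of_natIso e

variable {C : Type*} [Category* C] [Abelian C]

section Functor

variable {D : Type*} [Category* D] {Φ Ψ : D ⥤ CochainComplex C ℤ} (τ : Φ ⟶ Ψ)

/-- In degree `n`, the mapping cocone of `Φ ⟶ Ψ` is the direct sum of `Φⁿ` and `Ψⁿ⁻¹`. -/
noncomputable def mappingCoconeFunctorBicone (n : ℤ) :
    BinaryBicone (Φ ⋙ eval C (.up ℤ) n) (Ψ ⋙ eval C (.up ℤ) (n + -1)) where
  pt := mappingCoconeFunctor τ ⋙ eval C (.up ℤ) n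
  fst :=
    { app X := (mappingCocone.fst (τ.app X)).f n
      naturality _ _ _ := mappingCoconeMap_f_fst_f _ _ _ _ (by simp) _ }
  snd :=
    { app X := (mappingCocone.snd (τ.app X)).v n (n + -1) rfl
      naturality _ _ _ := mappingCoconeMap_f_snd_v _ _ _ _ (by simp) _ _ _ }
  inl :=
    { app X := (mappingCocone.inl (τ.app X)).v n n (add_zero n)
      naturality _ _ _ := (inl_v_mappingCoconeMap_f _ _ _ _ (by simp) _).symm }
  inr :=
    { app X := (mappingCocone.inr (τ.app X)).1.v (n + -1) n (by lia)
      naturality _ _ _ := (inr_v_mappingCoconeMap_f _ _ _ _ (by simp) _ _ _).symm }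
  inl_fst := by ext X; exact mappingCocone.inl_v_fst_f _ _
  inl_snd := by ext X; exact mappingCocone.inl_v_snd_v _ _ _ rfl
  inr_fst := by ext X; exact mappingCocone.inr_v_fst_f _ _ _ (by lia)
  inr_snd := by ext X; exact mappingCocone.inr_v_snd_v _ _ _ (by lia)

lemma preservesColimitsOfShape_mappingCoconeFunctor (J : Type*) [Category* J]
    [PreservesColimitsOfShape J Φ] [PreservesColimitsOfShape J Ψ] [HasColimitsOfShape J C] :
    PreservesColimitsOfShape J (mappingCoconeFunctor τ) :=
  preservesColimitsOfShape_of_eval _ fun n ↦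
    preservesColimitsOfShape_of_isColimit
      (isBinaryBilimitOfTotal (mappingCoconeFunctorBicone τ n) (by
        ext X
        exact mappingCocone.id_X (τ.app X) n (n + -1) rfl)).isColimit
      (by rintro ⟨_ | _⟩ <;> dsimp <;> infer_instance)

end Functor

lemma isZero_mappingCocone_X {K L : CochainComplex C ℤ} (φ : K ⟶ L) (n : ℤ) (hK : IsZero (K.X n))
    (hL : IsZero (L.X (n + -1))) : IsZero ((mappingCocone φ).X n) := by
  rw [IsZero.iff_id_eq_zero]
  exact mappingCocone_hom_ext φ rfl (hK.eq_of_tgt _ _) (hL.eq_of_tgt _ _)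

universe v

variable {A B : Type*} [Category.{v} A] [Category.{v} B] [Abelian A] [Abelian B]

/-- Functors between categories of cochain complexes which preserve colimits, monomorphisms,
quasi-isomorphisms, lower bounds, and upper bounds up to a shift. Such a functor has a right
adjoint, which descends to the bounded below derived categories. -/
structure IsCocontinuousExact (Φ : CochainComplex A ℤ ⥤ CochainComplex B ℤ) : Prop where
  preservesColimits : PreservesColimits Φ
  mono_map {K L : CochainComplex A ℤ} (φ : K ⟶ L) (_ : Mono φ) : Mono (Φ.map φ)
  quasiIso_map {K L : CochainComplex A ℤ} (φ : K ⟶ L) (_ : QuasiIso φ) : QuasiIso (Φ.map φ)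
  isStrictlyGE (K : CochainComplex A ℤ) (n : ℤ) (_ : K.IsStrictlyGE n) :
    (Φ.obj K).IsStrictlyGE n
  exists_isStrictlyLE : ∃ r : ℤ, ∀ (K : CochainComplex A ℤ) (n : ℤ), K.IsStrictlyLE n →
    (Φ.obj K).IsStrictlyLE (n + r)

lemma isCocontinuousExact_mapHomologicalComplex [HasColimits A] (G : A ⥤ B) [G.Additive]
    [PreservesFiniteLimits G] [PreservesColimits G] :
    IsCocontinuousExact (G.mapHomologicalComplex (ComplexShape.up ℤ)) where
  preservesColimits := ⟨inferInstance⟩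
  mono_map φ _ := mono_of_mono_f _ fun n ↦ inferInstanceAs (Mono (G.map (φ.f n)))
  quasiIso_map φ _ := inferInstance
  isStrictlyGE K n _ := by
    rw [isStrictlyGE_iff]
    exact fun i hi ↦ G.map_isZero (K.isZero_of_isStrictlyGE n i)
  exists_isStrictlyLE := ⟨0, fun K n _ ↦ by
    rw [isStrictlyLE_iff]
    exact fun i hi ↦ G.map_isZero (K.isZero_of_isStrictlyLE n i)⟩

lemma IsCocontinuousExact.mappingCoconeFunctor [HasColimits B]
    {Φ Ψ : CochainComplex A ℤ ⥤ CochainComplex B ℤ}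
    (hΦ : IsCocontinuousExact Φ) (hΨ : IsCocontinuousExact Ψ) (τ : Φ ⟶ Ψ) :
    IsCocontinuousExact (mappingCoconeFunctor τ) where
  preservesColimits := by
    have := hΦ.preservesColimits
    have := hΨ.preservesColimits
    exact ⟨fun {J} ↦ preservesColimitsOfShape_mappingCoconeFunctor τ J⟩
  mono_map φ _ := by
    have := hΦ.mono_map φ inferInstance
    have := hΨ.mono_map φ inferInstance
    exact mono_mappingCoconeMap _ _ _ _ _
  quasiIso_map φ _ := by
    have := hΦ.quasiIso_map φ inferInstance
    have := hΨ.quasiIso_map φ inferInstance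
    exact quasiIso_mappingCoconeMap _ _ _ _ _
  isStrictlyGE K n _ := by
    have := hΦ.isStrictlyGE K n inferInstance
    have := hΨ.isStrictlyGE K n inferInstance
    rw [isStrictlyGE_iff]
    exact fun i hi ↦ isZero_mappingCocone_X _ _ (isZero_of_isStrictlyGE _ n _)
      (isZero_of_isStrictlyGE _ n _)
  exists_isStrictlyLE := by
    obtain ⟨r, hr⟩ := hΦ.exists_isStrictlyLE
    obtain ⟨s, hs⟩ := hΨ.exists_isStrictlyLE
    refine ⟨max r (s + 1), fun K n _ ↦ ?_⟩
    have := hr K n inferInstance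
    have := hs K n inferInstance
    rw [isStrictlyLE_iff]
    exact fun i hi ↦ isZero_mappingCocone_X _ _ (isZero_of_isStrictlyLE _ (n + r) _)
      (isZero_of_isStrictlyLE _ (n + s) _)

end IsCocontinuousExact

section FunctorShortExact

open Limits

variable {A B : Type*} [Category* A] [Category* B] [Abelian B]

lemma shortExact_map_of_epi [Abelian A] (F : A ⥤ B) [F.PreservesZeroMorphisms]
    [PreservesFiniteLimits F] {S : ShortComplex A} (hS : S.ShortExact) (h : Epi (F.map S.g)) :
    (S.map F).ShortExact :=
  have := hS.mono_f
  .mk' (hS.exact.map_of_mono_of_preservesKernel F inferInstance inferInstance)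
    (inferInstanceAs (Mono (F.map S.f))) h

lemma shortExact_cokernel {X Y : B} (f : X ⟶ Y) [Mono f] :
    (ShortComplex.mk f (cokernel.π f) (cokernel.condition f)).ShortExact :=
  .mk' (ShortComplex.exact_cokernel f) inferInstance inferInstance

section

variable {E : ShortComplex (A ⥤ B)} (hE : E.ShortExact)

include hE

lemma shortExact_app (M : A) : (E.map ((evaluation A B).obj M)).ShortExact :=
  hE.map_of_exact _

lemma epi_g_app (M : A) : Epi (E.g.app M) := (shortExact_app hE M).epi_g

lemma additive_X₃ [Preadditive A] [E.X₂.Additive] : E.X₃.Additive where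
  map_add {M N f g} := by
    have := epi_g_app hE M
    rw [← cancel_epi (E.g.app M), ← E.g.naturality, E.X₂.map_add, Preadditive.add_comp,
      Preadditive.comp_add, E.g.naturality, E.g.naturality]

lemma preservesColimitsOfShape_X₃ (J : Type*) [Category* J] [PreservesColimitsOfShape J E.X₁]
    [PreservesColimitsOfShape J E.X₂] : PreservesColimitsOfShape J E.X₃ :=
  preservesColimitsOfShape_of_isColimit hE.gIsCokernel
    (by rintro (_ | _) <;> dsimp <;> infer_instance)

lemma mono_X₃_map [Abelian A] [E.X₁.PreservesZeroMorphisms] [PreservesFiniteLimits E.X₁]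
    [PreservesFiniteLimits E.X₂] {S : ShortComplex A} (hS : S.ShortExact) :
    Mono (E.X₃.map S.f) := by
  have := hS.mono_f
  have := epi_g_app hE S.X₁
  have (M : A) : Mono (E.f.app M) := (shortExact_app hE M).mono_f
  refine Preadditive.mono_of_cancel_zero _ fun {T} x hx ↦ ?_
  obtain ⟨T', p, _, t, ht⟩ := surjective_up_to_refinements_of_epi (E.g.app S.X₁) x
  obtain ⟨k, hk⟩ : ∃ k, k ≫ E.f.app S.X₂ = t ≫ E.X₂.map S.f :=
    have : Mono (E.map ((evaluation A B).obj S.X₂)).f := this _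
    (shortExact_app hE S.X₂).exact.lift' _ (by
      change (t ≫ E.X₂.map S.f) ≫ E.g.app S.X₂ = 0
      rw [Category.assoc, E.g.naturality, ← reassoc_of% ht, hx, comp_zero])
  have hk₀ : k ≫ E.X₁.map S.g = 0 := by
    rw [← cancel_mono (E.f.app S.X₃), Category.assoc, E.f.naturality, reassoc_of% hk,
      ← E.X₂.map_comp, S.zero, E.X₂.map_zero, comp_zero, zero_comp]
  obtain ⟨n, hn⟩ : ∃ n, n ≫ E.X₁.map S.f = k :=
    have : Mono (S.map E.X₁).f := inferInstanceAs (Mono (E.X₁.map S.f))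
    (hS.exact.map_of_mono_of_preservesKernel E.X₁ inferInstance inferInstance).lift' k hk₀
  have hnt : n ≫ E.f.app S.X₁ = t := by
    rw [← cancel_mono (E.X₂.map S.f), Category.assoc, ← E.f.naturality, reassoc_of% hn, hk]
  rw [← cancel_epi p, ht, ← hnt, Category.assoc]
  simp [← NatTrans.comp_app]

lemma preservesFiniteLimits_X₃ [Abelian A] [E.X₂.Additive] [E.X₁.PreservesZeroMorphisms]
    [PreservesFiniteLimits E.X₁] [PreservesFiniteLimits E.X₂]
    [PreservesFiniteColimits E.X₁] [PreservesFiniteColimits E.X₂] :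
    PreservesFiniteLimits E.X₃ := by
  have := additive_X₃ hE
  have : PreservesFiniteColimits E.X₃ := ⟨fun J _ _ ↦ preservesColimitsOfShape_X₃ hE J⟩
  suffices h : ∀ S : ShortComplex A, S.ShortExact → (S.map E.X₃).ShortExact from
    ((E.X₃.exact_tfae.out 0 3 rfl rfl).1 h).1
  intro S hS
  have := hS.epi_g
  exact .mk' (hS.exact.map_of_epi_of_preservesCokernel _ inferInstance inferInstance)
    (mono_X₃_map hE hS) (inferInstanceAs (Epi (E.X₃.map S.g)))

end

end FunctorShortExact

section Resolution

open Limits HomologicalComplex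

universe v

variable {A B : Type*} [Category.{v} A] [Category.{v} B] [Abelian A] [Abelian B]

lemma preservesColimits_of_epi_map (G : A ⥤ B) [G.Additive] [HasColimits A]
    [PreservesFiniteLimits G] [∀ J : Type v, PreservesColimitsOfShape (Discrete J) G]
    (hG : ∀ S : ShortComplex A, S.ShortExact → Epi (G.map S.g)) : PreservesColimits G := by
  obtain ⟨_, _⟩ : PreservesFiniteLimits G ∧ PreservesFiniteColimits G :=
    (G.exact_tfae.out 0 3).1 fun (S : ShortComplex A) (hS : S.ShortExact) ↦
      shortExact_map_of_epi G hS (hG S hS)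
  exact preservesColimits_of_preservesCoequalizers_and_coproducts G

variable {F : A ⥤ B} [F.Additive] [PreservesFiniteLimits F] {P : ObjectProperty A}
  (hP : IsAdaptedClass F P) {T : A ⥤ A} (η : 𝟭 A ⟶ T) [Mono η] (hT : ∀ M, P (T.obj M))

/-- The extension to cochain complexes of the complex `H ⋙ F ⟶ H ⋙ T ⋙ F ⟶ H ⋙ cokernel η ⋙ F`
of functors attached to an embedding `η` of the identity functor into `T`. -/
noncomputable def resolutionShortComplex (F : A ⥤ B) [F.Additive] (H : A ⥤ A) [H.Additive]
    [T.Additive] [(cokernel η).Additive] :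
    ShortComplex (CochainComplex A ℤ ⥤ CochainComplex B ℤ) where
  X₁ := (H ⋙ F).mapHomologicalComplex (.up ℤ)
  X₂ := (H ⋙ T ⋙ F).mapHomologicalComplex (.up ℤ)
  X₃ := ((H ⋙ cokernel η) ⋙ F).mapHomologicalComplex (.up ℤ)
  f := NatTrans.mapHomologicalComplex (H.whiskerLeft (Functor.whiskerRight η F)) _
  g := NatTrans.mapHomologicalComplex (H.whiskerLeft (Functor.whiskerRight (cokernel.π η) F)) _
  zero := by
    ext K n
    change F.map (η.app _) ≫ F.map ((cokernel.π η).app _) = 0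
    rw [← F.map_comp, ← NatTrans.comp_app, cokernel.condition, NatTrans.app_zero, F.map_zero]

lemma shortExact_resolutionShortComplex_obj (H : A ⥤ A) [H.Additive] [T.Additive]
    [(cokernel η).Additive] (K : CochainComplex A ℤ)
    (h : ∀ n, Epi (F.map ((cokernel.π η).app (H.obj (K.X n))))) :
    ((resolutionShortComplex η F H).map ((evaluation _ _).obj K)).ShortExact :=
  shortExact_of_degreewise_shortExact _ fun n ↦
    shortExact_map_of_epi F (shortExact_app (shortExact_cokernel η) (H.obj (K.X n))) (h n)

include hP hT η in
/-- The induction embeds `H` into `H ⋙ T` and takes for `Φ` the mapping cocone of the morphism from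
`H ⋙ T ⋙ F` to the functor already obtained for `H ⋙ cokernel η`. -/
theorem exists_isCocontinuousExact [T.Additive] [PreservesFiniteLimits T] [PreservesColimits T]
    [HasColimits A] [HasColimits B] [EnoughInjectives A]
    [∀ J : Type v, PreservesColimitsOfShape (Discrete J) F]
    (n : ℕ) (H : A ⥤ A) [H.Additive] [PreservesFiniteLimits H] [PreservesColimits H]
    (hH : ∀ M, HasAdaptedDimensionLE F P n (H.obj M)) :
    ∃ (Φ : CochainComplex A ℤ ⥤ CochainComplex B ℤ)
      (α : (H ⋙ F).mapHomologicalComplex (.up ℤ) ⟶ Φ), IsCocontinuousExact Φ ∧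
        ∀ K : CochainComplex A ℤ, (∀ i, P (H.obj (K.X i))) → QuasiIso (α.app K) := by
  have : PreservesFiniteColimits T := PreservesColimitsOfSize.preservesFiniteColimits T
  have : PreservesFiniteColimits H := PreservesColimitsOfSize.preservesFiniteColimits H
  induction n generalizing H with
  | zero =>
    have : PreservesColimits (H ⋙ F) := preservesColimits_of_epi_map _ fun S hS ↦
      hH S.X₁ (H.map S.f) (H.map S.g) _ (hS.map_of_exact H)
    exact ⟨_, 𝟙 _, isCocontinuousExact_mapHomologicalComplex _,
      fun K _ ↦ by rw [NatTrans.id_app]; infer_instance⟩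
  | succ n ih =>
    have hE := shortExact_cokernel η
    have hE' (M : A) := shortExact_app hE (H.obj M)
    have : (cokernel η).Additive := additive_X₃ hE
    have : PreservesFiniteLimits (cokernel η) := preservesFiniteLimits_X₃ hE
    have : PreservesColimits (cokernel η) := ⟨fun {J} ↦ preservesColimitsOfShape_X₃ hE J⟩
    obtain ⟨Φ, α, hΦ, hα⟩ := ih (H ⋙ cokernel η)
      (fun M ↦ hP.hasAdaptedDimensionLE_of_succ (hE' M) (hT _) (hH M)) inferInstance
    have : PreservesColimits (H ⋙ T ⋙ F) := preservesColimits_of_epi_map _ fun S hS ↦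
      hP.epi_map _ (hS.map_of_exact (H ⋙ T)) (hT _)
    let S := resolutionShortComplex η F H
    refine ⟨mappingCoconeFunctor (S.g ≫ α), liftMappingCoconeFunctor S α,
      (isCocontinuousExact_mapHomologicalComplex _).mappingCoconeFunctor hΦ _, fun K hK ↦ ?_⟩
    exact quasiIso_liftMappingCocone _
      (shortExact_resolutionShortComplex_obj η H K fun j ↦ hP.epi_map _ (hE' (K.X j)) (hK j))
      (hα K fun j ↦ hP.quotient _ (hE' (K.X j)) (hK j) (hT _))

end Resolution

section DerivedAdjunction

variable {C₀ C₁ C₂ D₁ D₂ : Type*} [Category* C₀] [Category* C₁] [Category* C₂] [Category* D₁]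
  [Category* D₂] {W₀ : MorphismProperty C₀} {W₁ : MorphismProperty C₁} {W₂ : MorphismProperty C₂}

lemma derives_of_isIso {Ψ : LocalizerMorphism W₀ W₁} {F : C₁ ⥤ D₂} {L : C₁ ⥤ D₁}
    [L.IsLocalization W₁] {G : D₁ ⥤ D₂} (γ : F ⟶ L ⋙ G)
    (hγ : ∀ X, IsIso (γ.app (Ψ.functor.obj X))) : Ψ.Derives F := by
  intro X Y f hf
  have := hγ X
  have := hγ Y
  have : IsIso (L.map (Ψ.functor.map f)) := Localization.inverts L W₁ _ (Ψ.map _ hf)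
  have : IsIso (F.map (Ψ.functor.map f) ≫ γ.app (Ψ.functor.obj Y)) := by
    rw [γ.naturality, Functor.comp_map]
    infer_instance
  exact IsIso.of_isIso_comp_right (F.map (Ψ.functor.map f)) (γ.app (Ψ.functor.obj Y))

/-- The right adjoint of `G'` is the right derived functor of `R`. -/
lemma exists_adjunction_of_derives {Ψ : LocalizerMorphism W₀ W₂} [Ψ.IsRightDerivabilityStructure]
    {G : C₁ ⥤ C₂} {R : C₂ ⥤ C₁} {L₁ : C₁ ⥤ D₁} (h : Ψ.Derives (R ⋙ L₁)) (adj : G ⊣ R)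
    [L₁.IsLocalization W₁] (L₂ : C₂ ⥤ D₂) [L₂.IsLocalization W₂] {G' : D₁ ⥤ D₂}
    (e : L₁ ⋙ G' ≅ G ⋙ L₂) : ∃ R' : D₂ ⥤ D₁, Nonempty (G' ⊣ R') := by
  have := h.hasPointwiseRightDerivedFunctor
  let R' : D₂ ⥤ D₁ := (R ⋙ L₁).totalRightDerived L₂ W₂
  let β : R ⋙ L₁ ⟶ L₂ ⋙ R' := (R ⋙ L₁).totalRightDerivedUnit L₂ W₂
  have hβ (X) : IsIso (β.app (Ψ.functor.obj X)) := h.isIso_of_isRightDerivedFunctor β X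
  have : G'.IsLeftDerivedFunctor e.hom W₁ := Functor.isLeftDerivedFunctor_of_inverts _ _ _
  have : (G' ⋙ R').IsLeftDerivedFunctor
      ((Functor.associator _ _ _).inv ≫ Functor.whiskerRight e.hom R') W₁ :=
    Functor.isLeftDerivedFunctor_of_inverts W₁ (G' ⋙ R')
      ((Functor.associator _ _ _).symm ≪≫ Functor.isoWhiskerRight e R')
  have hG' : Ψ.Derives ((R ⋙ L₁) ⋙ G') := fun _ _ f hf ↦
    have := h f hf
    inferInstanceAs (IsIso (G'.map ((Ψ.functor ⋙ R ⋙ L₁).map f)))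
  have : (R' ⋙ G').IsRightDerivedFunctor
      (Functor.whiskerRight β G' ≫ (Functor.associator _ _ _).hom) W₂ :=
    hG'.isRightDerivedFunctor_of_isIso _ fun X ↦ by
      have := hβ X
      rw [NatTrans.comp_app]
      dsimp only [Functor.whiskerRight_app, Functor.associator_hom_app]
      infer_instance
  exact ⟨R', ⟨adj.derived W₁ W₂ e.hom β⟩⟩

end DerivedAdjunction

section PlusLocalization

variable {A : Type*} [Category* A] [Abelian A]

variable (A) in
/-- The localization functor from bounded below cochain complexes to the bounded below derived
category. -/
noncomputable abbrev plusLocalization [HasDerivedCategory A] :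
    CochainComplex.Plus A ⥤ DerivedCategory.Plus A :=
  HomotopyCategory.Plus.quotient A ⋙ DerivedCategory.Plus.Qh

variable {B : Type*} [Category* B] [Abelian B]

lemma nonempty_rightDerivedFunctorPlus_iso [HasDerivedCategory A] [HasDerivedCategory B]
    [EnoughInjectives A] (F : A ⥤ B) [F.Additive]
    {Φ : CochainComplex.Plus A ⥤ CochainComplex.Plus B} (α : F.mapCochainComplexPlus ⟶ Φ)
    (hα : ∀ K : CochainComplex.Plus A, (∀ n, Injective (K.obj.X n)) →
      CochainComplex.Plus.quasiIso B (α.app K))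
    {G' : DerivedCategory.Plus A ⥤ DerivedCategory.Plus B}
    (e : plusLocalization A ⋙ G' ≅ Φ ⋙ plusLocalization B) :
    Nonempty (F.rightDerivedFunctorPlus ≅ G') := by
  let Ψ := CochainComplex.Plus.localizerMorphism A
  let FC := F.mapCochainComplexPlus ⋙ plusLocalization B
  let β : FC ⟶ plusLocalization A ⋙ F.rightDerivedFunctorPlus :=
    (HomotopyCategory.Plus.quotient A).whiskerLeft F.rightDerivedFunctorPlusUnit
  let γ : FC ⟶ plusLocalization A ⋙ G' := Functor.whiskerRight α (plusLocalization B) ≫ e.inv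
  have hβ (X) : IsIso (β.app (Ψ.functor.obj X)) :=
    inferInstanceAs (IsIso (F.rightDerivedFunctorPlusUnit.app
      ((HomotopyCategory.Plus.quotient A).obj
        ((InjectiveObject.ι A).mapCochainComplexPlus.obj X))))
  have hγ (X) : IsIso (γ.app (Ψ.functor.obj X)) := by
    have : IsIso ((plusLocalization B).map (α.app (Ψ.functor.obj X))) :=
      Localization.inverts _ (CochainComplex.Plus.quasiIso B) _ (hα _ fun n ↦ (X.obj.X n).property)
    simp only [γ, NatTrans.comp_app, Functor.whiskerRight_app]
    infer_instance
  have h : Ψ.Derives FC := derives_of_isIso γ hγ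
  have := h.isRightDerivedFunctor_of_isIso β hβ
  have := h.isRightDerivedFunctor_of_isIso γ hγ
  exact ⟨Functor.rightDerivedUnique _ _ β γ (CochainComplex.Plus.quasiIso A)⟩

end PlusLocalization

section PlusAdjunction

open Limits HomologicalComplex CochainComplex HomotopicalAlgebra Plus.modelCategoryQuillen

variable {A B : Type*} [Category* A] [Category* B] [Abelian A] [Abelian B]

section

variable [EnoughInjectives A] [EnoughInjectives B] {Φ : Plus A ⥤ Plus B} {Γ : Plus B ⥤ Plus A}
  (adj : Φ ⊣ Γ) (hΦ : ∀ ⦃X Y : Plus A⦄ (i : X ⟶ Y), Mono i → Mono (Φ.map i))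

include adj hΦ

omit [EnoughInjectives B] in
lemma weakEquivalence_map_of_trivialFibration {X Y : Plus B} (p : X ⟶ Y) [Fibration p]
    [WeakEquivalence p] : WeakEquivalence (Γ.map p) := by
  have : trivialFibrations _ (Γ.map p) := by
    rw [← cofibrations_rlp]
    intro U V i hi
    rw [← adj.hasLiftingProperty_iff]
    have : Mono (Φ.map i) := hΦ i ((Plus.modelCategoryQuillen.cofibration_iff i).1 ⟨hi⟩)
    infer_instance
  exact ⟨this.2⟩

/-- This is Ken Brown's lemma for the injective model structure. -/
lemma quasiIso_map_of_adjunction {K L : Plus B} (hK : ∀ n, Injective (K.obj.X n))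
    (hL : ∀ n, Injective (L.obj.X n)) (f : K ⟶ L) (hf : Plus.quasiIso B f) :
    Plus.quasiIso A (Γ.map f) := by
  have : IsFibrant K := (Plus.modelCategoryQuillen.isFibrant_iff K).2 hK
  have : IsFibrant L := (Plus.modelCategoryQuillen.isFibrant_iff L).2 hL
  have : WeakEquivalence f := ⟨hf⟩
  let φ : FibrantBrownFactorization f := Classical.arbitrary _
  have := weakEquivalence_map_of_trivialFibration adj hΦ φ.r
  have := weakEquivalence_map_of_trivialFibration adj hΦ φ.p
  have : WeakEquivalence (Γ.map φ.i ≫ Γ.map φ.r) := by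
    rw [← Γ.map_comp, φ.i_r, Γ.map_id]
    infer_instance
  have : WeakEquivalence (Γ.map φ.i) := weakEquivalence_of_postcomp _ (Γ.map φ.r)
  have : WeakEquivalence (Γ.map f) := by
    rw [← φ.fac, Γ.map_comp]
    infer_instance
  exact this.1

end

lemma eq_zero_of_isStrictlyLE_of_isStrictlyGE {K L : CochainComplex A ℤ} (f : K ⟶ L) (m n : ℤ)
    (h : m < n) [K.IsStrictlyLE m] [L.IsStrictlyGE n] : f = 0 := by
  ext i
  by_cases hi : m < i
  · exact (K.isZero_of_isStrictlyLE m i).eq_of_src _ _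
  · exact (L.isZero_of_isStrictlyGE n i).eq_of_tgt _ _

lemma isStrictlyGE_of_hom_eq_zero {L : CochainComplex A ℤ} {m : ℤ}
    (h : ∀ (K : CochainComplex A ℤ) (i : ℤ), i ≤ m → K.IsStrictlyLE i → ∀ x : K ⟶ L, x = 0) :
    L.IsStrictlyGE m := by
  rw [isStrictlyGE_iff]
  intro i hi
  have hi' : (ComplexShape.up ℤ).Rel i (i + 1) := rfl
  -- Maps from the two-term complex `L.X i ⟶ L.X i` in degrees `i`, `i + 1` are endomorphisms of
  -- `L.X i`.
  let K : CochainComplex A ℤ := double (𝟙 (L.X i)) hi'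
  let x : K ⟶ L := mkHomFromDouble hi' (by lia) (𝟙 _) (L.d i (i + 1)) (by simp) (by simp)
  have hK : K.IsStrictlyLE (i + 1) := by
    rw [isStrictlyLE_iff]
    exact fun j hj ↦ isZero_double_X _ _ _ (by lia) (by lia)
  have hx := congr_hom (h K (i + 1) (by lia) hK x) i
  rw [mkHomFromDouble_f₀] at hx
  rw [IsZero.iff_id_eq_zero, ← cancel_epi (doubleXIso₀ (𝟙 (L.X i)) hi').hom]
  simpa using hx

lemma isStrictlyGE_of_adjunction {Φ : CochainComplex A ℤ ⥤ CochainComplex B ℤ}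
    {Γ : CochainComplex B ℤ ⥤ CochainComplex A ℤ} (adj : Φ ⊣ Γ) (r : ℤ)
    (hr : ∀ (K : CochainComplex A ℤ) (n : ℤ), K.IsStrictlyLE n → (Φ.obj K).IsStrictlyLE (n + r))
    (L : CochainComplex B ℤ) (m : ℤ) [L.IsStrictlyGE m] :
    (Γ.obj L).IsStrictlyGE (m - r - 1) := by
  refine isStrictlyGE_of_hom_eq_zero fun K i hi hK x ↦ (adj.homEquiv K L).symm.injective ?_
  have := hr K i hK
  rw [eq_zero_of_isStrictlyLE_of_isStrictlyGE ((adj.homEquiv K L).symm x) (i + r) m (by lia),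
    eq_zero_of_isStrictlyLE_of_isStrictlyGE ((adj.homEquiv K L).symm 0) (i + r) m (by lia)]

end PlusAdjunction

section RightAdjoint

open Limits CochainComplex

universe v

variable {A B : Type*} [Category.{v} A] [Category.{v} B] [Abelian A] [Abelian B]

namespace IsCocontinuousExact

variable {Φ : CochainComplex A ℤ ⥤ CochainComplex B ℤ} (hΦ : IsCocontinuousExact Φ)

/-- The functor induced by `Φ` on bounded below complexes. -/
def plus : Plus A ⥤ Plus B :=
  ObjectProperty.lift _ (Plus.ι A ⋙ Φ) fun ⟨K, n, hn⟩ ↦ ⟨n, hΦ.isStrictlyGE K n hn⟩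

lemma exists_adjunction_plus [IsGrothendieckAbelian.{v} A] :
    ∃ Γ : Plus B ⥤ Plus A, Nonempty (hΦ.plus ⊣ Γ) := by
  have := hΦ.preservesColimits
  obtain ⟨r, hr⟩ := hΦ.exists_isStrictlyLE
  have : IsGrothendieckAbelian.{v} (CochainComplex A ℤ) := inferInstance
  have : Φ.IsLeftAdjoint :=
    isLeftAdjoint_of_preservesColimits_of_isSeparating (isSeparator_separator _) Φ
  let adj := Adjunction.ofIsLeftAdjoint Φ
  exact ⟨ObjectProperty.lift _ (Plus.ι B ⋙ Φ.rightAdjoint) fun ⟨L, n, hn⟩ ↦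
      ⟨_, isStrictlyGE_of_adjunction adj r hr L n⟩,
    ⟨adj.restrictFullyFaithful (Plus.fullyFaithfulι A) (Plus.fullyFaithfulι B) (Iso.refl _)
      (Iso.refl _)⟩⟩

lemma mono_plus_map {K L : Plus A} (f : K ⟶ L) (hf : Mono f) : Mono (hΦ.plus.map f) := by
  rw [Plus.mono_iff] at hf ⊢
  exact hΦ.mono_map f.hom hf

lemma isInvertedBy_plus [HasDerivedCategory B] :
    (Plus.quasiIso A).IsInvertedBy (hΦ.plus ⋙ plusLocalization B) := fun _ _ f hf ↦
  Localization.inverts (plusLocalization B) (Plus.quasiIso B) _ (hΦ.quasiIso_map f.hom hf)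

lemma exists_rightAdjoint [HasDerivedCategory A] [HasDerivedCategory B]
    [IsGrothendieckAbelian.{v} A] [EnoughInjectives B]
    {G : DerivedCategory.Plus A ⥤ DerivedCategory.Plus B}
    (e : plusLocalization A ⋙ G ≅ hΦ.plus ⋙ plusLocalization B) :
    ∃ R : DerivedCategory.Plus B ⥤ DerivedCategory.Plus A, Nonempty (G ⊣ R) := by
  obtain ⟨Γ, ⟨adj⟩⟩ := hΦ.exists_adjunction_plus
  have hΓ : (Plus.localizerMorphism B).Derives (Γ ⋙ plusLocalization A) := fun K L f hf ↦
    Localization.inverts (plusLocalization A) (Plus.quasiIso A) _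
      (quasiIso_map_of_adjunction adj (fun _ _ ↦ hΦ.mono_plus_map)
        (fun n ↦ (K.obj.X n).property) (fun n ↦ (L.obj.X n).property) _ hf)
  exact exists_adjunction_of_derives (W₁ := Plus.quasiIso A) hΓ adj (plusLocalization B) e

end IsCocontinuousExact

theorem exists_rightAdjoint_rightDerivedFunctorPlus
    [HasDerivedCategory A] [HasDerivedCategory B]
    [IsGrothendieckAbelian.{v} A] [IsGrothendieckAbelian.{v} B]
    {F : A ⥤ B} [F.Additive] [PreservesFiniteLimits F]
    [∀ J : Type v, PreservesColimitsOfShape (Discrete J) F]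
    {P : ObjectProperty A} (hP : IsAdaptedClass F P)
    {T : A ⥤ A} [T.Additive] [PreservesFiniteLimits T] [PreservesColimits T]
    (η : 𝟭 A ⟶ T) [Mono η] (hT : ∀ M, P (T.obj M))
    {d : ℕ} (hd : ∀ M, IsZero ((F.rightDerived (d + 1)).obj M)) :
    ∃ R : DerivedCategory.Plus B ⥤ DerivedCategory.Plus A,
      Nonempty (F.rightDerivedFunctorPlus ⊣ R) := by
  obtain ⟨Φ, α, hΦ, hα⟩ := exists_isCocontinuousExact hP η hT d (𝟭 A) fun M ↦
    hP.hasAdaptedDimensionLE_of_isZero_rightDerived (hd M)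
  let α' : F.mapCochainComplexPlus ⟶ hΦ.plus :=
    { app K := ObjectProperty.homMk (α.app K.obj)
      naturality K L f := by
        ext1
        exact α.naturality f.hom }
  have hα' (K : Plus A) (hK : ∀ n, Injective (K.obj.X n)) : Plus.quasiIso B (α'.app K) :=
    hα K.obj fun n ↦ hP.injective (K.obj.X n)
  let G : DerivedCategory.Plus A ⥤ DerivedCategory.Plus B :=
    Localization.lift _ hΦ.isInvertedBy_plus (plusLocalization A)
  let e : plusLocalization A ⋙ G ≅ hΦ.plus ⋙ plusLocalization B := Localization.fac _ _ _
  obtain ⟨i⟩ := nonempty_rightDerivedFunctorPlus_iso F α' hα' e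
  obtain ⟨R, ⟨adj⟩⟩ := hΦ.exists_rightAdjoint e
  exact ⟨R, ⟨adj.ofNatIsoLeft i.symm⟩⟩

end RightAdjoint

/-- Sheaves of abelian groups on a topological space. -/
abbrev AbSheaf (Y : TopCat.{u}) := TopCat.Sheaf AddCommGrpCat.{u} Y

namespace AbSheaf

variable {Y : TopCat.{u}}

/-- The group of sections of a sheaf over an open set. -/
def Sec (N : AbSheaf Y) (V : Opens Y) : Type u := N.obj.obj (op V)

noncomputable instance (N : AbSheaf Y) (V : Opens Y) : AddCommGroup (Sec N V) :=
  inferInstanceAs (AddCommGroup (N.obj.obj (op V)))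

/-- Restriction of sections. -/
noncomputable def res {N : AbSheaf Y} {V W : Opens Y} (h : W ≤ V) : Sec N V →+ Sec N W :=
  (N.obj.map (homOfLE h).op).hom

/-- The action of a morphism of sheaves on sections. -/
noncomputable def app {M N : AbSheaf Y} (φ : M ⟶ N) (V : Opens Y) : Sec M V →+ Sec N V :=
  (φ.hom.app (op V)).hom

variable {M N K : AbSheaf Y} {U V W : Opens Y}

@[simp]
lemma res_self (h : V ≤ V) (s : Sec N V) : res h s = s := by
  change N.obj.map (𝟙 _) s = s
  rw [N.obj.map_id]
  rfl

@[simp]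
lemma res_res (h : W ≤ V) (h' : U ≤ W) (s : Sec N V) : res h' (res h s) = res (h'.trans h) s := by
  change _ = N.obj.map ((homOfLE h).op ≫ (homOfLE h').op) s
  rw [N.obj.map_comp]
  rfl

lemma app_res (φ : M ⟶ N) (h : W ≤ V) (s : Sec M V) : app φ W (res h s) = res h (app φ V s) :=
  NatTrans.naturality_apply φ.hom (homOfLE h).op s

@[simp]
lemma app_comp (φ : M ⟶ N) (ψ : N ⟶ K) (s : Sec M V) : app (φ ≫ ψ) V s = app ψ V (app φ V s) :=
  rfl

@[simp]
lemma app_id (s : Sec M V) : app (𝟙 M) V s = s := rfl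

@[simp]
lemma app_zero (s : Sec M V) : app (0 : M ⟶ N) V s = 0 := rfl

lemma hom_ext {φ ψ : M ⟶ N} (h : ∀ (V : Opens Y) (s : Sec M V), app φ V s = app ψ V s) :
    φ = ψ := by
  apply CategoryTheory.Sheaf.hom_ext
  ext V s
  exact h V.unop s

/-- Morphisms of sheaves are families of homomorphisms compatible with restrictions. -/
noncomputable def homMk (φ : ∀ V : Opens Y, Sec M V →+ Sec N V)
    (hφ : ∀ (V W : Opens Y) (h : W ≤ V) (s : Sec M V), φ W (res h s) = res h (φ V s)) : M ⟶ N :=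
  ⟨{ app := fun V ↦ AddCommGrpCat.ofHom (φ V.unop)
     naturality := fun V W i ↦ by
      ext s
      exact hφ V.unop W.unop i.unop.le s }⟩

lemma sec_ext {s t : Sec N V}
    (h : ∀ y ∈ V, ∃ (W : Opens Y) (hW : W ≤ V), y ∈ W ∧ res hW s = res hW t) : s = t := by
  choose! W hW hy hst using h
  refine N.eq_of_locally_eq' (fun y : V ↦ W y.1) V (fun y ↦ homOfLE (hW y.1 y.2)) ?_ s t ?_
  · intro y hyV
    exact Opens.mem_iSup.mpr ⟨⟨y, hyV⟩, hy y hyV⟩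
  · rintro ⟨y, hyV⟩
    exact hst y hyV

lemma exists_glue {ι : Type u} (W : ι → Opens Y) (hW : ∀ i, W i ≤ V)
    (hV : ∀ y ∈ V, ∃ i, y ∈ W i) (s : ∀ i, Sec N (W i))
    (hs : ∀ i j, res (N := N) (inf_le_left : W i ⊓ W j ≤ W i) (s i) =
      res (N := N) (inf_le_right : W i ⊓ W j ≤ W j) (s j)) :
    ∃ t : Sec N V, ∀ i, res (hW i) t = s i := by
  obtain ⟨t, ht, -⟩ := N.existsUnique_gluing' W V (fun i ↦ homOfLE (hW i))
    (fun y hy ↦ Opens.mem_iSup.mpr (hV y hy)) s hs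
  exact ⟨t, ht⟩

lemma exists_glue₂ {W₁ W₂ : Opens Y} (h₁ : W₁ ≤ V) (h₂ : W₂ ≤ V)
    (hV : ∀ y ∈ V, y ∈ W₁ ∨ y ∈ W₂) (s₁ : Sec N W₁) (s₂ : Sec N W₂)
    (hs : res (inf_le_left : W₁ ⊓ W₂ ≤ W₁) s₁ = res (inf_le_right : W₁ ⊓ W₂ ≤ W₂) s₂) :
    ∃ t : Sec N V, res h₁ t = s₁ ∧ res h₂ t = s₂ := by
  have hs' : res (N := N) (inf_le_right : W₂ ⊓ W₁ ≤ W₁) s₁ =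
      res (N := N) (inf_le_left : W₂ ⊓ W₁ ≤ W₂) s₂ := by
    have := congrArg (res (N := N) (le_of_eq (inf_comm W₂ W₁))) hs
    simpa only [res_res] using this
  obtain ⟨t, ht⟩ := exists_glue (N := N) (V := V) (ι := ULift Bool)
    (fun b ↦ Bool.rec W₁ W₂ b.down) (by rintro ⟨_ | _⟩ <;> assumption)
    (fun y hy ↦ (hV y hy).elim (fun h ↦ ⟨⟨false⟩, h⟩) (fun h ↦ ⟨⟨true⟩, h⟩))
    (fun b ↦ Bool.rec (motive := fun c ↦ Sec N (Bool.rec W₁ W₂ c)) s₁ s₂ b.down)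
    (by
      rintro ⟨_ | _⟩ ⟨_ | _⟩
      · rfl
      · exact hs
      · exact hs'.symm
      · rfl)
  exact ⟨t, ht ⟨false⟩, ht ⟨true⟩⟩

/-- The support of a section of a sheaf. -/
def supp (s : Sec N V) : Set Y := sectionSupport N.obj (V := V) s

lemma not_mem_supp_iff {s : Sec N V} {y : Y} (hy : y ∈ V) :
    y ∉ supp s ↔ ∃ (W : Opens Y) (hW : W ≤ V), y ∈ W ∧ res hW s = 0 := by
  refine (not_mem_sectionSupport_iff (F := N.obj) hy).trans ?_
  constructor
  · intro h
    obtain ⟨W, hW, i, j, hij⟩ := TopCat.Presheaf.germ_eq N.obj y hy hy s 0 (by rw [h, map_zero])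
    rw [map_zero] at hij
    exact ⟨W, i.le, hW, hij⟩
  · rintro ⟨W, hW, hyW, h⟩
    refine (TopCat.Presheaf.germ_res_apply N.obj (homOfLE hW) y hyW s).symm.trans ?_
    change TopCat.Presheaf.germ N.obj W y hyW (res hW s) = 0
    rw [h]
    exact map_zero (TopCat.Presheaf.germ N.obj W y hyW).hom

lemma supp_subset (s : Sec N V) : supp s ⊆ V := fun _ h ↦ h.1

lemma supp_res (h : W ≤ V) (s : Sec N V) : supp (res h s) = supp s ∩ W :=
  sectionSupport_res N.obj (homOfLE h) s

lemma supp_app_subset (φ : M ⟶ N) (s : Sec M V) : supp (app φ V s) ⊆ supp s :=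
  sectionSupport_map_subset φ.hom s

lemma eq_zero_iff_supp {s : Sec N V} : s = 0 ↔ supp s = ∅ := by
  refine ⟨fun h ↦ by rw [h]; exact sectionSupport_zero _ _, fun h ↦ sec_ext fun y hy ↦ ?_⟩
  obtain ⟨W, hW, hyW, h'⟩ := (not_mem_supp_iff hy).mp (h ▸ Set.notMem_empty y)
  exact ⟨W, hW, hyW, by rw [h', map_zero]⟩

lemma res_eq_zero_iff (h : W ≤ V) (s : Sec N V) : res h s = 0 ↔ supp s ∩ W = ∅ := by
  rw [eq_zero_iff_supp, supp_res]

/-- The open complement of the support of a section within its domain. -/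
def zeroOpens (s : Sec N V) : Opens Y where
  carrier := {y | y ∈ V ∧ y ∉ supp s}
  is_open' := by
    rw [isOpen_iff_forall_mem_open]
    rintro y ⟨hy, h⟩
    obtain ⟨W, hW, hyW, h'⟩ := (not_mem_supp_iff hy).mp h
    exact ⟨W, fun z hz ↦ ⟨hW hz, (not_mem_supp_iff (hW hz)).mpr ⟨W, hW, hz, h'⟩⟩, W.isOpen, hyW⟩

lemma zeroOpens_le (s : Sec N V) : zeroOpens s ≤ V := fun _ h ↦ h.1

lemma res_zeroOpens (s : Sec N V) : res (zeroOpens_le s) s = 0 := by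
  rw [res_eq_zero_iff]
  ext y
  simp only [Set.mem_inter_iff, Set.mem_empty_iff_false, iff_false]
  exact fun h ↦ h.2.2 h.1

lemma exists_extend_zero (h : W ≤ V) (s : Sec N W) (O : Opens Y) (hO : O ≤ V)
    (hcov : ∀ y ∈ V, y ∈ W ∨ y ∈ O) (hs : ∀ y ∈ O, y ∉ supp s) :
    ∃ t : Sec N V, res h t = s ∧ supp t = supp s := by
  obtain ⟨t, ht, ht'⟩ := exists_glue₂ h hO hcov s 0 (by
    rw [map_zero, res_eq_zero_iff]
    ext y
    simp only [Set.mem_inter_iff, Set.mem_empty_iff_false, iff_false]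
    exact fun hy ↦ hs y hy.2.2 hy.1)
  refine ⟨t, ht, ?_⟩
  ext y
  constructor
  · intro hy
    rcases hcov y (supp_subset t hy) with h' | h'
    · rw [← ht, supp_res]
      exact ⟨hy, h'⟩
    · exact absurd (show y ∈ supp t ∩ O from ⟨hy, h'⟩)
        (by rw [(res_eq_zero_iff hO t).mp ht']; exact Set.notMem_empty y)
  · intro hy
    rw [← ht, supp_res] at hy
    exact hy.1

lemma mono_iff_injective (φ : M ⟶ N) :
    Mono φ ↔ ∀ V : Opens Y, Function.Injective (app φ V) := by
  constructor
  · intro h V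
    have : Mono φ.hom := (TopCat.Sheaf.forget AddCommGrpCat.{u} Y).map_mono φ
    exact (AddCommGrpCat.mono_iff_injective (φ.hom.app (op V))).mp inferInstance
  · intro h
    refine ⟨fun {Z} a b hab ↦ hom_ext fun V s ↦ h V ?_⟩
    rw [← app_comp, ← app_comp, hab]

lemma epi_iff_locallySurjective (φ : M ⟶ N) :
    Epi φ ↔ ∀ (V : Opens Y) (s : Sec N V), ∀ y ∈ V,
      ∃ (W : Opens Y) (hW : W ≤ V), y ∈ W ∧ ∃ t : Sec M W, app φ W t = res hW s := by
  rw [← TopCat.Sheaf.isLocallySurjective_iff_epi, TopCat.Presheaf.isLocallySurjective_iff]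
  constructor
  · intro h V s y hy
    obtain ⟨W, hW, ⟨t, ht⟩, hyW⟩ := h V s y hy
    exact ⟨W, hW, hyW, t, ht⟩
  · intro h V s y hy
    obtain ⟨W, hW, hyW, t, ht⟩ := h V s y hy
    exact ⟨W, hW, ⟨t, ht⟩, hyW⟩

section Stalks

/-- The stalk functor on sheaves of abelian groups. -/
noncomputable def stalk (y : Y) : AbSheaf Y ⥤ AddCommGrpCat.{u} :=
  TopCat.Sheaf.forget AddCommGrpCat.{u} Y ⋙ TopCat.Presheaf.stalkFunctor AddCommGrpCat.{u} y

instance (y : Y) : (stalk y).IsLeftAdjoint :=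
  inferInstanceAs (TopCat.Sheaf.forget AddCommGrpCat.{u} Y ⋙
    TopCat.Presheaf.stalkFunctor AddCommGrpCat.{u} y).IsLeftAdjoint

instance (y : Y) : (stalk y).Additive :=
  inferInstanceAs (TopCat.Sheaf.forget AddCommGrpCat.{u} Y ⋙
    TopCat.Presheaf.stalkFunctor AddCommGrpCat.{u} y).Additive

/-- The germ of a section at a point. -/
noncomputable def germ {y : Y} (hy : y ∈ V) : Sec N V →+ (stalk y).obj N :=
  (TopCat.Presheaf.germ N.obj V y hy).hom

lemma stalk_map_germ (φ : M ⟶ N) {y : Y} (hy : y ∈ V) (s : Sec M V) :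
    (stalk y).map φ (germ hy s) = germ hy (app φ V s) :=
  TopCat.Presheaf.stalkFunctor_map_germ_apply V y hy φ.hom s

lemma exists_germ_eq {y : Y} (x : (stalk y).obj N) :
    ∃ (V : Opens Y) (hy : y ∈ V) (s : Sec N V), germ hy s = x :=
  TopCat.Presheaf.exists_germ_eq N.obj x

lemma germ_res {y : Y} (h : W ≤ V) (hy : y ∈ W) (s : Sec N V) :
    germ hy (res h s) = germ (h hy) s :=
  TopCat.Presheaf.germ_res_apply N.obj (homOfLE h) y hy s

lemma exists_res_eq_of_germ_eq {y : Y} {hV : y ∈ V} {hW : y ∈ W} {s : Sec N V} {t : Sec N W}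
    (h : germ hV s = germ hW t) :
    ∃ (O : Opens Y) (h₁ : O ≤ V) (h₂ : O ≤ W), y ∈ O ∧ res h₁ s = res h₂ t := by
  obtain ⟨O, hO, i, j, hij⟩ := TopCat.Presheaf.germ_eq N.obj y hV hW s t h
  exact ⟨O, i.le, j.le, hO, hij⟩

end Stalks

lemma exact_iff (S : ShortComplex (AbSheaf Y)) :
    S.Exact ↔ ∀ (V : Opens Y) (s : Sec S.X₂ V), app S.g V s = 0 → ∀ y ∈ V,
      ∃ (W : Opens Y) (hW : W ≤ V), y ∈ W ∧ ∃ t : Sec S.X₁ W, app S.f W t = res hW s := by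
  rw [TopCat.Sheaf.exact_iff_stalkFunctor_map_exact]
  have h1 (y : Y) : (S.map (TopCat.Sheaf.forget AddCommGrpCat.{u} Y ⋙
      TopCat.Presheaf.stalkFunctor AddCommGrpCat.{u} y)).Exact ↔
      ∀ b, (stalk y).map S.g b = 0 → ∃ a, (stalk y).map S.f a = b := ShortComplex.ab_exact_iff _
  simp only [h1]
  constructor
  · intro h V s hs y hy
    obtain ⟨a, ha⟩ := h y (germ hy s) (by rw [stalk_map_germ, hs, map_zero])
    obtain ⟨W, hyW, t, rfl⟩ := exists_germ_eq a
    rw [stalk_map_germ] at ha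
    obtain ⟨O, i, j, hyO, hij⟩ := exists_res_eq_of_germ_eq ha
    exact ⟨O, j, hyO, res i t, by rw [app_res, hij]⟩
  · intro h y b hb
    obtain ⟨V, hy, s, rfl⟩ := exists_germ_eq b
    rw [stalk_map_germ, ← map_zero (germ (N := S.X₃) hy)] at hb
    obtain ⟨O, hO, _, hyO, hs⟩ := exists_res_eq_of_germ_eq hb
    obtain ⟨W, hW, hyW, t, ht⟩ := h O (res hO s) (by rw [app_res, hs, map_zero]) y hyO
    exact ⟨germ hyW t, by rw [stalk_map_germ, ht, res_res, germ_res]⟩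

lemma exists_app_f_eq {S : ShortComplex (AbSheaf Y)} (hS : S.Exact) [Mono S.f] (s : Sec S.X₂ V)
    (hs : app S.g V s = 0) : ∃ t : Sec S.X₁ V, app S.f V t = s :=
  TopCat.Sheaf.sections_exact_of_left_exact hS inferInstance s hs

lemma app_g_f (S : ShortComplex (AbSheaf Y)) (s : Sec S.X₁ V) : app S.g V (app S.f V s) = 0 := by
  rw [← app_comp, S.zero, app_zero]

lemma exact_of_sections (S : ShortComplex (AbSheaf Y))
    (h : ∀ (V : Opens Y) (s : Sec S.X₂ V), app S.g V s = 0 → ∃ t : Sec S.X₁ V, app S.f V t = s) :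
    S.Exact :=
  (exact_iff S).mpr fun V s hs y hy ↦ by
    obtain ⟨t, ht⟩ := h V s hs
    exact ⟨V, le_rfl, hy, t, by rw [ht, res_self]⟩

end AbSheaf

section Coproducts

open Limits

variable {J : Type*}

lemma mem_closure_range_cofan_inj {M : J → AddCommGrpCat.{u}} {c : Cofan M} (hc : IsColimit c)
    (x : c.pt) : x ∈ AddSubgroup.closure (⋃ a, Set.range (c.inj a)) := by
  set H := AddSubgroup.closure (⋃ a, Set.range (c.inj a))
  have hH : AddCommGrpCat.ofHom (QuotientAddGroup.mk' H) = 0 := by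
    refine Cofan.IsColimit.hom_ext hc _ _ fun a ↦ ?_
    ext m
    refine (QuotientAddGroup.eq_zero_iff _).mpr (AddSubgroup.subset_closure ?_)
    exact Set.mem_iUnion.mpr ⟨a, m, rfl⟩
  exact (QuotientAddGroup.eq_zero_iff x).mp (ConcreteCategory.congr_hom hH x)

variable {C : Type*} [Category* C] [HasZeroMorphisms C]

open Classical in
lemma sigma_ι_comp_π_comp_ι (M : J → C) [HasCoproduct M] (a b : J) :
    Sigma.ι M a ≫ Sigma.π M b ≫ Sigma.ι M b = if a = b then Sigma.ι M a else 0 := by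
  split_ifs with h
  · subst h
    rw [← Category.assoc, Sigma.ι_π_eq_id, Category.id_comp]
  · rw [← Category.assoc, Sigma.ι_π_of_ne M h, zero_comp]

open Classical Filter in
lemma eventually_sum_map_π_comp_ι (G : C ⥤ AddCommGrpCat.{u}) [G.PreservesZeroMorphisms]
    (M : J → C) [HasCoproduct M] [PreservesColimit (Discrete.functor M) G] (x : G.obj (∐ M)) :
    ∀ᶠ S : Finset J in atTop, ∑ a ∈ S, G.map (Sigma.π M a ≫ Sigma.ι M a) x = x := by
  let c := Cofan.mk (G.obj (∐ M)) fun a ↦ G.map (Sigma.ι M a)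
  have hc : IsColimit c := isColimitMapCoconeCofanMkEquiv G _ _
    (isColimitOfPreserves G (coproductIsCoproduct M))
  induction mem_closure_range_cofan_inj hc x using AddSubgroup.closure_induction with
  | mem x hx =>
    obtain ⟨a, m, rfl⟩ := Set.mem_iUnion.mp hx
    have hm (b : J) : G.map (Sigma.π M b ≫ Sigma.ι M b) (G.map (Sigma.ι M a) m) =
        if a = b then G.map (Sigma.ι M a) m else 0 := by
      rw [← ConcreteCategory.comp_apply, ← G.map_comp, sigma_ι_comp_π_comp_ι]
      split_ifs
      · rfl
      · rw [G.map_zero]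
        rfl
    filter_upwards [eventually_ge_atTop {a}] with S hS
    refine (Finset.sum_congr rfl fun b _ ↦ hm b).trans ?_
    rw [Finset.sum_ite_eq, if_pos (Finset.singleton_subset_iff.mp hS)]
    rfl
  | zero => exact Eventually.of_forall fun S ↦ by simp only [map_zero, Finset.sum_const_zero]
  | add x z _ _ hx hz =>
    filter_upwards [hx, hz] with S hx hz
    simp only [map_add, Finset.sum_add_distrib, hx, hz]
  | neg x _ hx =>
    filter_upwards [hx] with S hx
    simp only [map_neg, Finset.sum_neg_distrib, hx]

end Coproducts

namespace AbSheaf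

section LocalResolution

open Limits Filter

variable {Y : TopCat.{u}} {M N : AbSheaf Y} {V : Opens Y} {J : Type u}

/-- A family of endomorphisms of a sheaf is a local resolution of the identity if on any
section, any sufficiently large finite sum of its members is locally the identity. Coproducts of
sheaves are recognised by means of such families, see `isIso_sigmaDesc`. -/
def IsLocalResolution (e : J → (N ⟶ N)) : Prop :=
  ∀ (V : Opens Y) (s : Sec N V), ∀ y ∈ V, ∃ (W : Opens Y) (hW : W ≤ V), y ∈ W ∧
    ∀ᶠ S : Finset J in atTop, ∑ a ∈ S, app (e a) W (res hW s) = res hW s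

lemma IsLocalResolution.eq_zero {e : J → (N ⟶ N)} (he : IsLocalResolution e) {s : Sec N V}
    (hs : ∀ a, app (e a) V s = 0) : s = 0 := by
  refine sec_ext fun y hy ↦ ?_
  obtain ⟨W, hW, hyW, hS⟩ := he V s y hy
  obtain ⟨S, hS⟩ := hS.exists
  refine ⟨W, hW, hyW, ?_⟩
  rw [map_zero, ← hS]
  exact Finset.sum_eq_zero fun a _ ↦ by rw [app_res, hs, map_zero]

open Classical in
lemma isLocalResolution_sigma (M : J → AbSheaf Y) :
    IsLocalResolution (fun a ↦ Sigma.π M a ≫ Sigma.ι M a) := by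
  intro V s y hy
  set e := fun a ↦ Sigma.π M a ≫ Sigma.ι M a with he
  have orthogonal (a b : J) (hab : a ≠ b) : e a ≫ e b = 0 := by
    simp only [he, Category.assoc, sigma_ι_comp_π_comp_ι, if_neg hab, comp_zero]
  obtain ⟨S, hS⟩ := (eventually_sum_map_π_comp_ι (stalk y) M (germ hy s)).exists
  have hgerm : germ hy (∑ a ∈ S, app (e a) V s) = germ hy s := by
    rw [map_sum, ← hS]
    exact Finset.sum_congr rfl fun a _ ↦ (stalk_map_germ (e a) hy s).symm
  obtain ⟨W, hWV, _, hyW, hs⟩ := exists_res_eq_of_germ_eq hgerm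
  have hsum : ∑ a ∈ S, app (e a) W (res hWV s) = res hWV s := by
    simpa only [map_sum, ← app_res] using hs
  refine ⟨W, hWV, hyW, ?_⟩
  filter_upwards [eventually_ge_atTop S] with S' hS'
  rw [← Finset.sum_subset hS' fun b _ hb ↦ ?_, hsum]
  rw [← hsum, map_sum]
  refine Finset.sum_eq_zero fun a ha ↦ ?_
  rw [← app_comp, orthogonal a b fun hab ↦ hb (hab ▸ ha), app_zero]

open Classical in
lemma isIso_sigmaDesc {M : J → AbSheaf Y} (ι : ∀ a, M a ⟶ N) (π : ∀ a, N ⟶ M a)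
    (h₁ : ∀ a, ι a ≫ π a = 𝟙 _) (h₂ : ∀ a b, a ≠ b → ι a ≫ π b = 0)
    (h : IsLocalResolution (fun a ↦ π a ≫ ι a)) : IsIso (Sigma.desc ι) := by
  have hπ (a : J) : Sigma.desc ι ≫ π a = Sigma.π M a := Sigma.hom_ext _ _ fun b ↦ by
    rw [← Category.assoc, Sigma.ι_desc]
    by_cases hb : b = a
    · subst hb
      rw [h₁, Sigma.ι_π_eq_id]
    · rw [h₂ b a hb, Sigma.ι_π_of_ne M hb]
  have : Mono (Sigma.desc ι) := (mono_iff_injective _).mpr fun V ↦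
    (injective_iff_map_eq_zero _).mpr fun s hs ↦
      (isLocalResolution_sigma M).eq_zero fun a ↦ by
        rw [← hπ, Category.assoc, app_comp, hs, map_zero]
  have : Epi (Sigma.desc ι) := (epi_iff_locallySurjective _).mpr fun V s y hy ↦ by
    obtain ⟨W, hW, hyW, hS⟩ := h V s y hy
    obtain ⟨S, hS⟩ := hS.exists
    refine ⟨W, hW, hyW, ∑ a ∈ S, app (Sigma.ι M a) W (app (π a) W (res hW s)), ?_⟩
    rw [map_sum]
    refine (Finset.sum_congr rfl fun a _ ↦ ?_).trans hS
    rw [← app_comp, Sigma.ι_desc, app_comp]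
  exact isIso_of_mono_of_epi _

open Classical in
lemma preservesCoproducts_of_isLocalResolution {X : TopCat.{u}} (F : AbSheaf Y ⥤ AbSheaf X)
    [F.PreservesZeroMorphisms] (hF : ∀ (N : AbSheaf Y) (e : J → (N ⟶ N)), IsLocalResolution e →
      IsLocalResolution (fun a ↦ F.map (e a))) :
    PreservesColimitsOfShape (Discrete J) F := by
  have (M : J → AbSheaf Y) : PreservesColimit (Discrete.functor M) F := by
    have : IsIso (sigmaComparison F M) :=
      isIso_sigmaDesc (fun a ↦ F.map (Sigma.ι M a)) (fun a ↦ F.map (Sigma.π M a))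
        (fun a ↦ by rw [← F.map_comp, Sigma.ι_π_eq_id, F.map_id])
        (fun a b hab ↦ by rw [← F.map_comp, Sigma.ι_π_of_ne M hab, F.map_zero])
        (by simpa only [F.map_comp] using hF _ _ (isLocalResolution_sigma M))
    exact PreservesCoproduct.of_iso_comparison F M
  exact preservesColimitsOfShape_of_discrete F

end LocalResolution

open Limits

variable {Y : TopCat.{u}}

section Sheafification

/-- Sheafification of presheaves of abelian groups. -/
noncomputable def sheafify (Y : TopCat.{u}) : ((Opens Y)ᵒᵖ ⥤ AddCommGrpCat.{u}) ⥤ AbSheaf Y :=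
  presheafToSheaf (Opens.grothendieckTopology Y) AddCommGrpCat.{u}

instance : (sheafify Y).Additive :=
  inferInstanceAs (presheafToSheaf (Opens.grothendieckTopology Y) AddCommGrpCat.{u}).Additive

variable {P Q : (Opens Y)ᵒᵖ ⥤ AddCommGrpCat.{u}}

/-- The section of the sheafification represented by a section of the presheaf. -/
noncomputable def toSec {V : Opens Y} : P.obj (op V) →+ Sec ((sheafify Y).obj P) V :=
  ((toSheafify (Opens.grothendieckTopology Y) P).app (op V)).hom

lemma res_toSec {V W : Opens Y} (h : W ≤ V) (p : P.obj (op V)) :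
    res h (toSec p) = toSec (P.map (homOfLE h).op p) :=
  (NatTrans.naturality_apply (toSheafify (Opens.grothendieckTopology Y) P) (homOfLE h).op p).symm

lemma app_toSec (φ : P ⟶ Q) {V : Opens Y} (p : P.obj (op V)) :
    app ((sheafify Y).map φ) V (toSec p) = toSec (φ.app (op V) p) :=
  (ConcreteCategory.congr_hom (NatTrans.congr_app
    (toSheafify_naturality (Opens.grothendieckTopology Y) φ) (op V)) p).symm

lemma exists_toSec {V : Opens Y} (t : Sec ((sheafify Y).obj P) V) {y : Y} (hy : y ∈ V) :
    ∃ (W : Opens Y) (hW : W ≤ V) (p : P.obj (op W)), y ∈ W ∧ toSec p = res hW t := by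
  have : TopCat.Presheaf.IsLocallySurjective (toSheafify (Opens.grothendieckTopology Y) P) :=
    inferInstanceAs (CategoryTheory.Presheaf.IsLocallySurjective (Opens.grothendieckTopology Y)
      (toSheafify (Opens.grothendieckTopology Y) P))
  obtain ⟨W, hW, ⟨p, hp⟩, hyW⟩ := (TopCat.Presheaf.isLocallySurjective_iff _).mp this V t y hy
  exact ⟨W, hW, p, hyW, hp⟩

lemma exists_map_eq_of_toSec_eq {V : Opens Y} {p q : P.obj (op V)}
    (h : toSec p = toSec q) {y : Y} (hy : y ∈ V) :
    ∃ (W : Opens Y) (hW : W ≤ V), y ∈ W ∧ P.map (homOfLE hW).op p = P.map (homOfLE hW).op q := by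
  obtain ⟨W, i, hi, hW⟩ := CategoryTheory.Presheaf.equalizerSieve_mem
    (Opens.grothendieckTopology Y) (toSheafify (Opens.grothendieckTopology Y) P) p q h y hy
  exact ⟨W, i.le, hW, hi⟩

end Sheafification

variable {M N : AbSheaf Y} {V W : Opens Y}

section FiniteFunctions

/-- The group of functions `V → M(V)` with finitely many values. -/
def finFun (M : AbSheaf Y) (V : Opens Y) : AddSubgroup (V → Sec M V) where
  carrier := {p | (Set.range p).Finite}
  zero_mem' := (Set.finite_singleton 0).subset (by rintro _ ⟨y, rfl⟩; rfl)
  add_mem' {p q} hp hq := (hp.add hq).subset (by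
    rintro _ ⟨y, rfl⟩
    exact Set.add_mem_add ⟨y, rfl⟩ ⟨y, rfl⟩)
  neg_mem' {p} hp := (hp.neg).subset (by
    rintro _ ⟨y, rfl⟩
    exact Set.neg_mem_neg.mpr ⟨y, rfl⟩)

/-- Restriction of functions with finitely many values. -/
noncomputable def finRes (h : W ≤ V) : finFun M V →+ finFun M W where
  toFun p := ⟨fun y ↦ res h (p.1 ⟨y.1, h y.2⟩), (p.2.image (res h)).subset (by
    rintro _ ⟨y, rfl⟩
    exact ⟨_, ⟨_, rfl⟩, rfl⟩)⟩
  map_zero' := Subtype.ext (funext fun _ ↦ map_zero _)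
  map_add' _ _ := Subtype.ext (funext fun _ ↦ map_add _ _ _)

lemma finRes_apply (h : W ≤ V) (p : finFun M V) (y : W) :
    (finRes h p).1 y = res h (p.1 ⟨y.1, h y.2⟩) := rfl

/-- The presheaf `V ↦ finFun M V`. -/
noncomputable def finPresheaf (M : AbSheaf Y) : (Opens Y)ᵒᵖ ⥤ AddCommGrpCat.{u} where
  obj V := AddCommGrpCat.of (finFun M V.unop)
  map i := AddCommGrpCat.ofHom (finRes i.unop.le)
  map_id V := by
    refine ConcreteCategory.hom_ext _ _ fun (p : finFun M V.unop) ↦ ?_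
    exact Subtype.ext (funext fun y ↦ res_self le_rfl (p.1 y))
  map_comp {V _ _} i j := by
    refine ConcreteCategory.hom_ext _ _ fun (p : finFun M V.unop) ↦ ?_
    exact Subtype.ext (funext fun y ↦ (res_res i.unop.le j.unop.le (p.1 _)).symm)

/-- Postcomposition of functions with finitely many values with a morphism of sheaves. -/
noncomputable def finFunMap (φ : M ⟶ N) (V : Opens Y) : finFun M V →+ finFun N V where
  toFun p := ⟨fun y ↦ app φ V (p.1 y), (p.2.image (app φ V)).subset (by
    rintro _ ⟨y, rfl⟩
    exact ⟨_, ⟨_, rfl⟩, rfl⟩)⟩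
  map_zero' := Subtype.ext (funext fun _ ↦ map_zero _)
  map_add' _ _ := Subtype.ext (funext fun _ ↦ map_add _ _ _)

/-- The functor `M ↦ finPresheaf M`. -/
noncomputable def finPresheafFunctor (Y : TopCat.{u}) :
    AbSheaf Y ⥤ (Opens Y)ᵒᵖ ⥤ AddCommGrpCat.{u} where
  obj M := finPresheaf M
  map φ :=
    { app := fun V ↦ AddCommGrpCat.ofHom (finFunMap φ V.unop)
      naturality := fun V W i ↦ by
        ext p
        exact Subtype.ext (funext fun y ↦ app_res φ i.unop.le _) }
  map_id _ := rfl
  map_comp _ _ := rfl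

instance : (finPresheafFunctor Y).Additive where
  map_add := rfl

/-- The functor `M ↦ M ⊗ B`, where `B` is the sheaf of integer valued functions that locally have
finitely many values: it sends `M` to the sheafification of `finPresheaf M`. It is exact, commutes
with colimits, and its values are soft because `B` contains all characteristic functions. -/
noncomputable def finSheaf (Y : TopCat.{u}) : AbSheaf Y ⥤ AbSheaf Y :=
  finPresheafFunctor Y ⋙ sheafify Y

instance : (finSheaf Y).Additive :=
  inferInstanceAs (finPresheafFunctor Y ⋙ sheafify Y).Additive

/-- The section of `finSheaf Y` represented by a function. -/
noncomputable def finSec : finFun M V →+ Sec ((finSheaf Y).obj M) V :=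
  toSec (P := finPresheaf M)

lemma res_finSec (h : W ≤ V) (p : finFun M V) : res h (finSec p) = finSec (finRes h p) :=
  res_toSec (P := finPresheaf M) h p

lemma app_finSheaf_map (φ : M ⟶ N) (p : finFun M V) :
    app ((finSheaf Y).map φ) V (finSec p) = finSec (finFunMap φ V p) :=
  app_toSec ((finPresheafFunctor Y).map φ) p

lemma exists_finSec (t : Sec ((finSheaf Y).obj M) V) {y : Y} (hy : y ∈ V) :
    ∃ (W : Opens Y) (hW : W ≤ V) (p : finFun M W), y ∈ W ∧ finSec p = res hW t :=
  exists_toSec (P := finPresheaf M) t hy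

lemma exists_finRes_eq_zero {p : finFun M V} (h : finSec p = 0) {y : Y} (hy : y ∈ V) :
    ∃ (W : Opens Y) (hW : W ≤ V), y ∈ W ∧ finRes hW p = 0 := by
  obtain ⟨W, hW, hyW, h⟩ := exists_map_eq_of_toSec_eq (P := finPresheaf M) (p := p) (q := 0)
    (h.trans (map_zero finSec).symm) hy
  exact ⟨W, hW, hyW, h.trans (map_zero (finRes hW))⟩

lemma exists_common_opens {α : Type*} {S : Set α} (hS : S.Finite) {y : Y} (hy : y ∈ V)
    (Q : α → Opens Y → Prop) (hQ : ∀ a W W', W' ≤ W → Q a W → Q a W')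
    (h : ∀ a ∈ S, ∃ W, y ∈ W ∧ Q a W) : ∃ W ≤ V, y ∈ W ∧ ∀ a ∈ S, Q a W := by
  induction S, hS using Set.Finite.induction_on with
  | empty => exact ⟨V, le_rfl, hy, fun _ ha ↦ absurd ha (Set.notMem_empty _)⟩
  | @insert a S _ _ ih =>
    obtain ⟨W, hWV, hyW, hW⟩ := ih fun b hb ↦ h b (Set.mem_insert_of_mem _ hb)
    obtain ⟨W', hyW', hW'⟩ := h a (Set.mem_insert _ _)
    refine ⟨W ⊓ W', inf_le_left.trans hWV, ⟨hyW, hyW'⟩, fun b hb ↦ ?_⟩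
    rcases hb with rfl | hb
    · exact hQ _ _ _ inf_le_right hW'
    · exact hQ _ _ _ inf_le_left (hW b hb)

lemma finSheaf_map_exact (S : ShortComplex (AbSheaf Y)) (hS : S.Exact) :
    (S.map (finSheaf Y)).Exact := by
  rw [exact_iff] at hS ⊢
  intro V (s : Sec ((finSheaf Y).obj S.X₂) V) (hs : app ((finSheaf Y).map S.g) V s = 0) y hy
  obtain ⟨W, hW, p, hyW, hp⟩ := exists_finSec s hy
  obtain ⟨W', hW', hyW', hp0⟩ := exists_finRes_eq_zero (p := finFunMap S.g W p)
    (by rw [← app_finSheaf_map, hp, app_res, hs, map_zero]) hyW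
  have hq (z : W') : app S.g W' ((finRes hW' p).1 z) = 0 := by
    rw [finRes_apply, app_res]
    exact congrFun (congrArg Subtype.val hp0) z
  -- As `p` takes finitely many values, they lift to `S.X₁` on a common neighborhood of `y`.
  obtain ⟨O, hO, hyO, hlift⟩ := exists_common_opens (finRes hW' p).2 hyW'
    (fun m O ↦ ∃ (hO : O ≤ W') (t : Sec S.X₁ O), app S.f O t = res hO m)
    (fun m O O' hO ⟨hOW, t, ht⟩ ↦
      ⟨hO.trans hOW, res hO t, by rw [app_res, ht, res_res]⟩)
    (by
      rintro _ ⟨z, rfl⟩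
      obtain ⟨O, hO, hyO, t, ht⟩ := hS W' _ (hq z) y hyW'
      exact ⟨O, hyO, hO, t, ht⟩)
  choose! _ lift hlift using hlift
  let r : finFun S.X₁ O := ⟨fun z ↦ lift ((finRes hW' p).1 ⟨z.1, hO z.2⟩),
    ((finRes hW' p).2.image lift).subset (by
      rintro _ ⟨z, rfl⟩
      exact ⟨_, ⟨_, rfl⟩, rfl⟩)⟩
  refine ⟨O, hO.trans (hW'.trans hW), hyO, (finSec r : Sec ((finSheaf Y).obj S.X₁) O), ?_⟩
  have hsO : res (hO.trans (hW'.trans hW)) s = finSec (finRes (hO.trans hW') p) := by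
    rw [← res_finSec, hp, res_res]
  refine (app_finSheaf_map S.f r).trans (Eq.trans ?_ hsO.symm)
  congr 1
  exact Subtype.ext (funext fun z ↦ (hlift _ ⟨_, rfl⟩).trans (res_res hW' hO _))

instance : PreservesFiniteLimits (finSheaf Y) :=
  ((finSheaf Y).exact_tfae.out 1 3 rfl rfl).mp finSheaf_map_exact |>.1

instance : PreservesFiniteColimits (finSheaf Y) :=
  ((finSheaf Y).exact_tfae.out 1 3 rfl rfl).mp finSheaf_map_exact |>.2

open Classical Filter in
lemma isLocalResolution_finSheaf_map {J : Type u} {e : J → (N ⟶ N)} (he : IsLocalResolution e) :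
    IsLocalResolution (fun a ↦ (finSheaf Y).map (e a)) := by
  intro V t y hy
  obtain ⟨W, hW, p, hyW, hp⟩ := exists_finSec t hy
  obtain ⟨O, hO, hyO, hsum⟩ := exists_common_opens p.2 hyW
    (fun m O ↦ ∃ hO : O ≤ W, ∀ᶠ S : Finset J in atTop,
      ∑ a ∈ S, app (e a) O (res hO m) = res hO m)
    (by
      rintro m O O' hO ⟨hOW, hS⟩
      refine ⟨hO.trans hOW, hS.mono fun S hS ↦ ?_⟩
      simpa only [map_sum, ← app_res, res_res] using congrArg (res hO) hS)
    (by
      rintro m -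
      obtain ⟨O, hO, hyO, hS⟩ := he W m y hyW
      exact ⟨O, hyO, hO, hS⟩)
  refine ⟨O, hO.trans hW, hyO, ?_⟩
  have hsum' : ∀ᶠ S : Finset J in atTop, ∀ m ∈ Set.range p.1,
      ∑ a ∈ S, app (e a) O (res hO m) = res hO m :=
    (Filter.eventually_all_finite p.2).mpr fun m hm ↦ (hsum m hm).2
  filter_upwards [hsum'] with S hS
  rw [← res_res hW hO, ← hp, res_finSec]
  simp only [app_finSheaf_map]
  rw [← map_sum]
  congr 1
  refine Subtype.ext (funext fun z ↦ ?_)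
  rw [AddSubgroup.val_finsetSum, Finset.sum_apply]
  exact hS _ ⟨⟨z.1, hO z.2⟩, rfl⟩

instance (J : Type u) : PreservesColimitsOfShape (Discrete J) (finSheaf Y) :=
  preservesCoproducts_of_isLocalResolution _ fun _ _ h ↦ isLocalResolution_finSheaf_map h

instance : PreservesColimits (finSheaf Y) :=
  preservesColimits_of_epi_map (finSheaf Y) fun S hS ↦ by
    have := hS.epi_g
    infer_instance

/-- The constant function attached to a section. -/
def finConst : Sec M V →+ finFun M V where
  toFun s := ⟨fun _ ↦ s, (Set.finite_singleton s).subset (by rintro _ ⟨y, rfl⟩; rfl)⟩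
  map_zero' := rfl
  map_add' _ _ := rfl

/-- The embedding `M ⟶ M ⊗ B` sending a section to the corresponding constant function. -/
noncomputable def toFinSheaf (Y : TopCat.{u}) : 𝟭 (AbSheaf Y) ⟶ finSheaf Y where
  app M := homMk (M := M) (N := (finSheaf Y).obj M) (fun _ ↦ finSec.comp finConst)
    (fun _ _ h s ↦ (res_finSec h (finConst s)).symm)
  naturality M _ φ := hom_ext fun _ (s : Sec M _) ↦ (app_finSheaf_map φ (finConst s)).symm

instance (M : AbSheaf Y) : Mono ((toFinSheaf Y).app M) := by
  rw [mono_iff_injective]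
  intro V
  rw [injective_iff_map_eq_zero]
  intro (s : Sec M V) (hs : finSec (finConst s) = 0)
  refine sec_ext (N := M) fun y hy ↦ ?_
  obtain ⟨W, hW, hyW, h⟩ := exists_finRes_eq_zero hs hy
  exact ⟨W, hW, hyW, (congrFun (congrArg Subtype.val h) ⟨y, hyW⟩).trans (map_zero _).symm⟩

instance : Mono (toFinSheaf Y) := NatTrans.mono_of_mono_app _

open Classical in
/-- Multiplication of functions with finitely many values by the characteristic function of a
subset `E` of `Y`. -/
noncomputable def finIndicator (E : Set Y) (V : Opens Y) : finFun M V →+ finFun M V where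
  toFun p := ⟨fun y ↦ if y.1 ∈ E then p.1 y else 0, (p.2.insert 0).subset (by
    rintro _ ⟨y, rfl⟩
    dsimp only
    split_ifs
    · exact Or.inr ⟨y, rfl⟩
    · exact Or.inl rfl)⟩
  map_zero' := Subtype.ext (funext fun _ ↦ ite_self _)
  map_add' p q := Subtype.ext (funext fun y ↦ by
    change (if y.1 ∈ E then p.1 y + q.1 y else 0) =
      (if y.1 ∈ E then p.1 y else 0) + (if y.1 ∈ E then q.1 y else 0)
    split_ifs
    · rfl
    · rw [add_zero])

open Classical in
lemma finRes_finIndicator (E : Set Y) (h : W ≤ V) (p : finFun M V) :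
    finRes h (finIndicator E V p) = finIndicator E W (finRes h p) :=
  Subtype.ext (funext fun y ↦ (apply_ite (res h) (y.1 ∈ E) _ _).trans (by rw [map_zero]; rfl))

/-- Multiplication by the characteristic function of `E` on `M ⊗ B`. -/
noncomputable def indicator (M : AbSheaf Y) (E : Set Y) :
    (finSheaf Y).obj M ⟶ (finSheaf Y).obj M :=
  (sheafify Y).map (X := finPresheaf M) (Y := finPresheaf M)
    { app := fun V ↦ AddCommGrpCat.ofHom (finIndicator E V.unop)
      naturality := fun _ _ i ↦ by
        ext p
        exact (finRes_finIndicator E i.unop.le p).symm }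

lemma app_indicator_finSec (E : Set Y) (p : finFun M V) :
    app (indicator M E) V (finSec p) = finSec (finIndicator E V p) :=
  app_toSec (P := finPresheaf M) (Q := finPresheaf M) _ p

variable {E : Set Y}

lemma app_indicator_of_disjoint (hV : Disjoint (V : Set Y) E) (s : Sec ((finSheaf Y).obj M) V) :
    app (indicator M E) V s = 0 := by
  refine sec_ext fun y hy ↦ ?_
  obtain ⟨W, hW, p, hyW, hp⟩ := exists_finSec s hy
  refine ⟨W, hW, hyW, ?_⟩
  rw [← app_res, ← hp, app_indicator_finSec, map_zero, ← map_zero finSec]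
  congr 1
  exact Subtype.ext (funext fun z ↦ if_neg fun hz ↦ Set.disjoint_left.mp hV (hW z.2) hz)

lemma app_indicator_of_subset (hV : (V : Set Y) ⊆ E) (s : Sec ((finSheaf Y).obj M) V) :
    app (indicator M E) V s = s := by
  refine sec_ext fun y hy ↦ ?_
  obtain ⟨W, hW, p, hyW, hp⟩ := exists_finSec s hy
  refine ⟨W, hW, hyW, ?_⟩
  rw [← app_res, ← hp, app_indicator_finSec]
  congr 1
  exact Subtype.ext (funext fun z ↦ if_pos (hV (hW z.2)))

end FiniteFunctions

end AbSheaf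

namespace MapsProperly

variable {Y X : Type*} [TopologicalSpace Y] [TopologicalSpace X] {f : Y → X} {P Q W : Set Y}
  {U U' : Set X} {x : X}

lemma restrict (hf : Continuous f) (h : MapsProperly f P U) (hU : U' ⊆ U) :
    MapsProperly f (P ∩ f ⁻¹' U') U' := by
  rw [mapsProperly_iff hf] at h ⊢
  refine ⟨fun y hy ↦ hy.2, fun 𝒰 h𝒰 x hx hlim ↦ ?_⟩
  obtain ⟨y, hy, rfl, hle⟩ :=
    h.2 𝒰 (Filter.mem_of_superset h𝒰 Set.inter_subset_left) x (hU hx) hlim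
  exact ⟨y, ⟨hy, hx⟩, rfl, hle⟩

lemma union (hf : Continuous f) (hP : MapsProperly f P U) (hQ : MapsProperly f Q U) :
    MapsProperly f (P ∪ Q) U := by
  rw [mapsProperly_iff hf] at hP hQ ⊢
  refine ⟨hP.1.union hQ.1, fun 𝒰 h𝒰 x hx hlim ↦ ?_⟩
  rcases Ultrafilter.union_mem_iff.mp h𝒰 with h | h
  · obtain ⟨y, hy, h⟩ := hP.2 𝒰 h x hx hlim
    exact ⟨y, Or.inl hy, h⟩
  · obtain ⟨y, hy, h⟩ := hQ.2 𝒰 h x hx hlim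
    exact ⟨y, Or.inr hy, h⟩

lemma empty (hf : Continuous f) (U : Set X) : MapsProperly f ∅ U :=
  (mapsProperly_iff hf).mpr ⟨Set.mapsTo_empty _ _, fun 𝒰 h ↦ absurd h 𝒰.empty_notMem⟩

lemma isCompact_fiber (hf : Continuous f) (h : MapsProperly f P U) (hx : x ∈ U) :
    IsCompact (P ∩ f ⁻¹' {x}) := by
  rw [mapsProperly_iff hf] at h
  rw [isCompact_iff_ultrafilter_le_nhds]
  intro 𝒰 h𝒰
  rw [Filter.le_principal_iff] at h𝒰
  obtain ⟨y, hy, hyx, hle⟩ := h.2 𝒰 (Filter.mem_of_superset h𝒰 Set.inter_subset_left) x hx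
    (tendsto_nhds_of_eventually_eq (Filter.mem_of_superset h𝒰 fun _ h ↦ h.2))
  exact ⟨y, ⟨hy, hyx⟩, hle⟩

lemma exists_tube (hf : Continuous f) (h : MapsProperly f P U) (hx : x ∈ U) (hW : IsOpen W)
    (hPW : P ∩ f ⁻¹' {x} ⊆ W) : ∃ O : Set X, IsOpen O ∧ x ∈ O ∧ P ∩ f ⁻¹' O ⊆ W := by
  rw [mapsProperly_iff hf] at h
  have hbot : Filter.comap f (𝓝 x) ⊓ Filter.principal (P \ W) = ⊥ := by
    by_contra hne
    have : (Filter.comap f (𝓝 x) ⊓ Filter.principal (P \ W)).NeBot := ⟨hne⟩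
    obtain ⟨𝒰, h𝒰⟩ := Ultrafilter.exists_le (Filter.comap f (𝓝 x) ⊓ Filter.principal (P \ W))
    have hPW' : P \ W ∈ 𝒰 := Filter.le_principal_iff.mp (h𝒰.trans inf_le_right)
    obtain ⟨y, hy, hyx, hle⟩ := h.2 𝒰 (Filter.mem_of_superset hPW' Set.sdiff_subset) x hx
      (Filter.tendsto_iff_comap.mpr (h𝒰.trans inf_le_left))
    obtain ⟨z, hz, hz'⟩ := 𝒰.nonempty_of_mem
      (Filter.inter_mem hPW' (hle (hW.mem_nhds (hPW ⟨hy, hyx⟩))))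
    exact hz.2 hz'
  rw [Filter.inf_principal_eq_bot, Filter.mem_comap] at hbot
  obtain ⟨N, hN, hNW⟩ := hbot
  obtain ⟨O, hON, hO, hxO⟩ := mem_nhds_iff.mp hN
  refine ⟨O, hO, hxO, fun y hy ↦ ?_⟩
  by_contra hyW
  exact hNW (hON hy.2) ⟨hy.1, hyW⟩

end MapsProperly

section Separated

variable {Y X : Type*} [TopologicalSpace Y] {f : Y → X} {x : X} {C D : Set Y}

lemma eq_of_isSeparatedMap (hsep : IsSeparatedMap f) {l : Filter Y} [l.NeBot] {y z : Y}
    (hyz : f y = f z) (hy : l ≤ 𝓝 y) (hz : l ≤ 𝓝 z) : y = z := by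
  by_contra hne
  have hdisj := isSeparatedMap_iff_disjoint_nhds.mp hsep y z hyz hne
  exact Filter.NeBot.ne ‹_› (disjoint_self.mp (hdisj.mono hy hz))

lemma isCompact_inter_of_isSeparatedMap (hsep : IsSeparatedMap f) (hC : IsCompact C)
    (hD : IsCompact D) (hCx : C ⊆ f ⁻¹' {x}) (hDx : D ⊆ f ⁻¹' {x}) : IsCompact (C ∩ D) := by
  rw [isCompact_iff_ultrafilter_le_nhds] at hC hD ⊢
  intro 𝒰 h𝒰
  obtain ⟨y, hy, hle⟩ := hC 𝒰 (h𝒰.trans (Filter.principal_mono.mpr Set.inter_subset_left))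
  obtain ⟨z, hz, hle'⟩ := hD 𝒰 (h𝒰.trans (Filter.principal_mono.mpr Set.inter_subset_right))
  have hyz : y = z := eq_of_isSeparatedMap hsep ((hCx hy).trans (hDx hz).symm) hle hle'
  exact ⟨y, ⟨hy, hyz ▸ hz⟩, hle⟩

lemma separatedNhds_of_isSeparatedMap (hsep : IsSeparatedMap f) (hC : IsCompact C)
    (hD : IsCompact D) (hCx : C ⊆ f ⁻¹' {x}) (hDx : D ⊆ f ⁻¹' {x}) (hCD : Disjoint C D) :
    SeparatedNhds C D := by
  rw [separatedNhds_iff_disjoint, hC.disjoint_nhdsSet_left]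
  intro y hy
  rw [hD.disjoint_nhdsSet_right]
  intro z hz
  exact isSeparatedMap_iff_disjoint_nhds.mp hsep y z ((hCx hy).trans (hDx hz).symm)
    fun h ↦ Set.disjoint_left.mp hCD hy (h ▸ hz)

lemma exists_isOpen_inter_subset {O : Set Y} (hsep : IsSeparatedMap f) (hC : IsCompact C)
    (hD : IsCompact D) (hCx : C ⊆ f ⁻¹' {x}) (hDx : D ⊆ f ⁻¹' {x}) (hO : IsOpen O)
    (hCD : C ∩ D ⊆ O) :
    ∃ G H : Set Y, IsOpen G ∧ IsOpen H ∧ C ⊆ G ∧ D ⊆ H ∧ G ∩ H ⊆ O := by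
  obtain ⟨G, H, hG, hH, hCG, hDH, hGH⟩ := separatedNhds_of_isSeparatedMap hsep (hC.diff hO)
    (hD.diff hO) (Set.sdiff_subset.trans hCx) (Set.sdiff_subset.trans hDx)
    (Set.disjoint_left.mpr fun y hy hy' ↦ hy.2 (hCD ⟨hy.1, hy'.1⟩))
  refine ⟨O ∪ G, O ∪ H, hO.union hG, hO.union hH, Set.sdiff_subset_iff.mp hCG,
    Set.sdiff_subset_iff.mp hDH, ?_⟩
  rw [← Set.union_inter_distrib_left, hGH.inter_eq, Set.union_empty]

variable [TopologicalSpace X] {P : Set Y} {U : Set X}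

lemma MapsProperly.isOpen_diff (hf : Continuous f) (hsep : IsSeparatedMap f)
    (h : MapsProperly f P U) (hU : IsOpen U) : IsOpen (f ⁻¹' U \ P) := by
  rw [mapsProperly_iff hf] at h
  rw [isOpen_iff_ultrafilter]
  intro y hy 𝒰 hle
  rw [← Ultrafilter.mem_coe, Set.sdiff_eq]
  refine Filter.inter_mem (hle ((hU.preimage hf).mem_nhds hy.1)) ?_
  rw [Ultrafilter.mem_coe, Ultrafilter.compl_mem_iff_notMem]
  intro hP
  obtain ⟨z, hz, hzy, hle'⟩ := h.2 𝒰 hP (f y) hy.1 ((hf.tendsto y).mono_left hle)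
  exact hy.2 (eq_of_isSeparatedMap hsep hzy hle' hle ▸ hz)

end Separated

namespace IsLocallyProperMap

variable {Y X : Type*} [TopologicalSpace Y] [TopologicalSpace X] {f : Y → X} {x : X}
  {C W : Set Y} {U : Set X}

lemma exists_mapsProperly_of_mem (hlp : IsLocallyProperMap f) {y : Y} (hW : IsOpen W) (hy : y ∈ W)
    (hU : IsOpen U) (hyU : f y ∈ U) :
    ∃ (O : Set X) (P : Set Y), IsOpen O ∧ f y ∈ O ∧ O ⊆ U ∧ P ⊆ W ∧ MapsProperly f P O ∧
      y ∈ interior P := by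
  obtain ⟨A, hA, hAW, B, hB, hAB⟩ := hlp.2 y W (hW.mem_nhds hy)
  have hO : IsOpen (interior B ∩ U) := isOpen_interior.inter hU
  have hyO : f y ∈ interior B ∩ U := ⟨mem_interior_iff_mem_nhds.mpr hB, hyU⟩
  refine ⟨interior B ∩ U, A ∩ f ⁻¹' (interior B ∩ U), hO, hyO, Set.inter_subset_right,
    Set.inter_subset_left.trans hAW,
    hAB.restrict hlp.1 (Set.inter_subset_left.trans interior_subset), ?_⟩
  rw [interior_inter, (hO.preimage hlp.1).interior_eq]
  exact ⟨mem_interior_iff_mem_nhds.mpr hA, hyO⟩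

lemma exists_mapsProperly (hlp : IsLocallyProperMap f) (hC : IsCompact C) (hCx : C ⊆ f ⁻¹' {x})
    (hW : IsOpen W) (hCW : C ⊆ W) (hU : IsOpen U) (hx : x ∈ U) :
    ∃ (O : Set X) (P : Set Y), IsOpen O ∧ x ∈ O ∧ O ⊆ U ∧ P ⊆ W ∧ MapsProperly f P O ∧
      C ⊆ interior P := by
  have hf := hlp.1
  rw [← Set.inter_eq_left.mpr hCx]
  refine hC.induction_on (p := fun t ↦ ∃ (O : Set X) (P : Set Y), IsOpen O ∧ x ∈ O ∧ O ⊆ U ∧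
    P ⊆ W ∧ MapsProperly f P O ∧ t ∩ f ⁻¹' {x} ⊆ interior P) ?_ ?_ ?_ ?_
  · exact ⟨U, ∅, hU, hx, subset_rfl, Set.empty_subset _, .empty hf _,
      Set.inter_subset_left.trans (Set.empty_subset _)⟩
  · rintro s t hst ⟨O, P, hO, hxO, hOU, hPW, hP, ht⟩
    exact ⟨O, P, hO, hxO, hOU, hPW, hP, (Set.inter_subset_inter_left _ hst).trans ht⟩
  · rintro s t ⟨O, P, hO, hxO, hOU, hPW, hP, hs⟩ ⟨O', P', hO', hxO', -, hPW', hP', ht⟩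
    have hpre : IsOpen (f ⁻¹' (O ∩ O')) := (hO.inter hO').preimage hf
    refine ⟨O ∩ O', P ∩ f ⁻¹' (O ∩ O') ∪ P' ∩ f ⁻¹' (O ∩ O'), hO.inter hO', ⟨hxO, hxO'⟩,
      Set.inter_subset_left.trans hOU,
      Set.union_subset (Set.inter_subset_left.trans hPW) (Set.inter_subset_left.trans hPW'),
      (hP.restrict hf Set.inter_subset_left).union hf (hP'.restrict hf Set.inter_subset_right), ?_⟩
    rintro y ⟨hy | hy, rfl⟩
    · refine interior_mono Set.subset_union_left ?_
      rw [interior_inter, hpre.interior_eq]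
      exact ⟨hs ⟨hy, rfl⟩, hxO, hxO'⟩
    · refine interior_mono Set.subset_union_right ?_
      rw [interior_inter, hpre.interior_eq]
      exact ⟨ht ⟨hy, rfl⟩, hxO, hxO'⟩
  · intro y hy
    obtain rfl : f y = x := hCx hy
    obtain ⟨O, P, hO, hyO, hOU, hPW, hP, hyP⟩ := hlp.exists_mapsProperly_of_mem hW (hCW hy) hU hx
    exact ⟨interior P, mem_nhdsWithin_of_mem_nhds (isOpen_interior.mem_nhds hyP), O, P, hO, hyO,
      hOU, hPW, hP, Set.inter_subset_left⟩

end IsLocallyProperMap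

namespace AbSheaf

section Soft

variable {Y X : TopCat.{u}} {f : Y ⟶ X} {M N : AbSheaf Y} {W : Opens Y} {U U' : Opens X}
  {P : Set Y} {x : X}

/-- The preimage of an open set. -/
abbrev pre (f : Y ⟶ X) (U : Opens X) : Opens Y := (Opens.map f).obj U

lemma pre_mono (h : U' ≤ U) : pre f U' ≤ pre f U := fun _ hy ↦ h hy

lemma preimage_singleton_subset_pre (hx : x ∈ U) : f ⁻¹' {x} ⊆ pre f U := by
  rintro y rfl
  exact hx

lemma mapsProperly_supp_of_subset {s : Sec N (pre f U)} (hP : MapsProperly f P U)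
    (hs : supp s ⊆ P) : MapsProperly f (supp s) U := by
  rw [mapsProperly_iff f.hom.continuous] at hP ⊢
  refine ⟨fun y hy ↦ hP.1 (hs hy), fun 𝒰 h x hx hlim ↦ ?_⟩
  obtain ⟨y, hy, hyx, hle⟩ := hP.2 𝒰 (Filter.mem_of_superset h hs) x hx hlim
  exact ⟨y, mem_sectionSupport_of_ultrafilter (hP.1 hy) hle h, hyx, hle⟩

/-- The complement of a subset proper over `U` inside the preimage of `U`. -/
def properCompl (hsep : IsSeparatedMap f) (hP : MapsProperly f P U) : Opens Y :=
  ⟨f ⁻¹' U \ P, hP.isOpen_diff f.hom.continuous hsep U.isOpen⟩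

lemma properCompl_le (hsep : IsSeparatedMap f) (hP : MapsProperly f P U) :
    properCompl hsep hP ≤ pre f U := fun _ hy ↦ hy.1

lemma res_properCompl_eq_zero (hsep : IsSeparatedMap f) (hP : MapsProperly f P U)
    (h : properCompl hsep hP ≤ W) {s : Sec N W} (hs : supp s ∩ pre f U ⊆ P) : res h s = 0 :=
  (res_eq_zero_iff h s).mpr <| Set.eq_empty_of_forall_notMem fun _ hy ↦
    hy.2.2 (hs ⟨hy.1, hy.2.1⟩)

lemma exists_extend_zero_of_mapsProperly (hsep : IsSeparatedMap f) (hP : MapsProperly f P U)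
    (hW : W ≤ pre f U) (hPW : P ⊆ W) (s : Sec N W) (hs : supp s ⊆ P) :
    ∃ t : Sec N (pre f U), res hW t = s ∧ supp t = supp s :=
  exists_extend_zero hW s (properCompl hsep hP) (properCompl_le hsep hP)
    (fun _ hy ↦ or_iff_not_imp_left.mpr fun hyW ↦ ⟨hy, fun hyP ↦ hyW (hPW hyP)⟩)
    (fun _ hy hys ↦ hy.2 (hs hys))

/-- A sheaf on `Y` is `f`-soft if sections near a compact subset of a fiber extend, after shrinking
to a smaller neighborhood, to sections with proper support over a neighborhood of the base point.
These are the sheaves by which `R f_(!)` is computed. -/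
def IsSoft (f : Y ⟶ X) (M : AbSheaf Y) : Prop :=
  ∀ (x : X) (C : Set Y) (W : Opens Y), IsCompact C → C ⊆ f ⁻¹' {x} → C ⊆ W → ∀ s : Sec M W,
    ∃ (U : Opens X) (t : Sec M (pre f U)), x ∈ U ∧ MapsProperly f (supp t) U ∧
      ∃ (O : Opens Y) (h₁ : O ≤ W) (h₂ : O ≤ pre f U), C ⊆ O ∧ res h₂ t = res h₁ s

lemma IsSoft.of_retract (hN : IsSoft f N) (r : M ⟶ N) (q : N ⟶ M) (h : r ≫ q = 𝟙 M) :
    IsSoft f M := by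
  intro x C W hC hCx hCW s
  obtain ⟨U, t, hx, ht, O, h₁, h₂, hCO, hts⟩ := hN x C W hC hCx hCW (app r W s)
  refine ⟨U, app q _ t, hx, mapsProperly_supp_of_subset ht (supp_app_subset q t), O, h₁, h₂, hCO,
    ?_⟩
  rw [← app_res, hts, ← app_res, ← app_comp, h, app_id]

lemma supp_app_indicator_subset (hP : MapsProperly f P U) (hsep : IsSeparatedMap f)
    (hW : W ≤ pre f U) (s : Sec ((finSheaf Y).obj M) W) :
    supp (app (indicator M P) W s) ⊆ P := by
  intro y hy
  by_contra hyP
  have hyW := supp_subset _ hy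
  refine (not_mem_supp_iff hyW).mpr ⟨W ⊓ properCompl hsep hP, inf_le_left,
    ⟨hyW, hW hyW, hyP⟩, ?_⟩ hy
  rw [← app_res, app_indicator_of_disjoint]
  exact Set.disjoint_left.mpr fun _ hz ↦ hz.2.2

lemma isSoft_finSheaf (hsep : IsSeparatedMap f) (hlp : IsLocallyProperMap f) (M : AbSheaf Y) :
    IsSoft f ((finSheaf Y).obj M) := by
  intro x C W hC hCx hCW s
  obtain ⟨O, P, hO, hx, -, hPW, hP, hCP⟩ :=
    hlp.exists_mapsProperly hC hCx W.isOpen hCW isOpen_univ (Set.mem_univ x)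
  lift O to Opens X using hO
  obtain ⟨t, ht, hts⟩ := exists_extend_zero_of_mapsProperly hsep hP
    (inf_le_right : W ⊓ pre f O ≤ pre f O) (Set.subset_inter hPW hP.1)
    (app (indicator M P) _ (res inf_le_left s)) (supp_app_indicator_subset hP hsep inf_le_right _)
  have hPO : (⟨interior P, isOpen_interior⟩ : Opens Y) ≤ W ⊓ pre f O :=
    interior_subset.trans (Set.subset_inter hPW hP.1)
  refine ⟨O, t, hx, mapsProperly_supp_of_subset hP (hts ▸ supp_app_indicator_subset hP hsep
    inf_le_right _), ⟨interior P, isOpen_interior⟩, hPO.trans inf_le_left, hPO.trans inf_le_right,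
    hCP, ?_⟩
  rw [← res_res inf_le_right hPO, ht, ← app_res, res_res]
  exact app_indicator_of_subset interior_subset _

lemma isSoft_of_injective (hsep : IsSeparatedMap f) (hlp : IsLocallyProperMap f) (I : AbSheaf Y)
    [Injective I] : IsSoft f I :=
  (isSoft_finSheaf hsep hlp I).of_retract ((toFinSheaf Y).app I)
    (Injective.factorThru (𝟙 I) ((toFinSheaf Y).app I)) (Injective.comp_factorThru _ _)

end Soft

section Lift

variable {Y X : TopCat.{u}} {f : Y ⟶ X} {V₁ V₂ W : Opens Y} {x : X} {C K₁ K₂ : Set Y}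

lemma exists_lift_sup {M N : AbSheaf Y} {φ : M ⟶ N} (h₁ : V₁ ≤ W) (h₂ : V₂ ≤ W) {s : Sec N W}
    {t₁ : Sec M V₁} {t₂ : Sec M V₂} (ht₁ : app φ V₁ t₁ = res h₁ s) (ht₂ : app φ V₂ t₂ = res h₂ s)
    (h : res (inf_le_left : V₁ ⊓ V₂ ≤ V₁) t₁ = res (inf_le_right : V₁ ⊓ V₂ ≤ V₂) t₂) :
    ∃ t : Sec M (V₁ ⊔ V₂), app φ _ t = res (sup_le h₁ h₂) s ∧ res le_sup_left t = t₁ := by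
  obtain ⟨t, ht, ht'⟩ := exists_glue₂ le_sup_left le_sup_right (fun _ hy ↦ hy) t₁ t₂ h
  refine ⟨t, sec_ext fun y hy ↦ ?_, ht⟩
  rcases hy with hy | hy
  · exact ⟨V₁, le_sup_left, hy, by rw [← app_res, ht, ht₁, res_res]⟩
  · exact ⟨V₂, le_sup_right, hy, by rw [← app_res, ht', ht₂, res_res]⟩

variable {S : ShortComplex (AbSheaf Y)}

/-- Two lifts differ by a section of the soft sheaf near `K₁ ∩ K₂`. Extending this section to a
neighborhood of the fiber, one corrects the second lift so that it agrees with the first one. -/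
lemma exists_lift_union (hsep : IsSeparatedMap f) (hS : S.ShortExact) (h₁ : IsSoft f S.X₁)
    (hK₁ : IsCompact K₁) (hK₂ : IsCompact K₂) (hK₁x : K₁ ⊆ f ⁻¹' {x}) (hK₂x : K₂ ⊆ f ⁻¹' {x})
    (hKV₁ : K₁ ⊆ V₁) (hKV₂ : K₂ ⊆ V₂) (hV₁ : V₁ ≤ W) (hV₂ : V₂ ≤ W) {s : Sec S.X₃ W}
    {t₁ : Sec S.X₂ V₁} {t₂ : Sec S.X₂ V₂} (ht₁ : app S.g V₁ t₁ = res hV₁ s)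
    (ht₂ : app S.g V₂ t₂ = res hV₂ s) :
    ∃ (B₁ B : Opens Y) (hB₁ : B₁ ≤ V₁) (hB₁B : B₁ ≤ B) (hB : B ≤ W) (t : Sec S.X₂ B),
      K₁ ⊆ B₁ ∧ K₂ ⊆ B ∧ app S.g B t = res hB s ∧ res hB₁B t = res hB₁ t₁ := by
  have := hS.mono_f
  obtain ⟨a, ha⟩ := exists_app_f_eq hS.exact
    (res (inf_le_left : V₁ ⊓ V₂ ≤ V₁) t₁ - res (inf_le_right : V₁ ⊓ V₂ ≤ V₂) t₂)
    (by rw [map_sub, app_res, app_res, ht₁, ht₂, res_res, res_res, sub_self])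
  obtain ⟨U, a', hx, -, O, hO, hOU, hKO, haO⟩ := h₁ x (K₁ ∩ K₂) (V₁ ⊓ V₂)
    (isCompact_inter_of_isSeparatedMap hsep hK₁ hK₂ hK₁x hK₂x)
    (Set.inter_subset_left.trans hK₁x) (Set.inter_subset_inter hKV₁ hKV₂) a
  obtain ⟨G₁, G₂, hG₁, hG₂, hKG₁, hKG₂, hG⟩ :=
    exists_isOpen_inter_subset hsep hK₁ hK₂ hK₁x hK₂x O.isOpen hKO
  lift G₁ to Opens Y using hG₁
  lift G₂ to Opens Y using hG₂
  have hB₁ : V₁ ⊓ G₁ ≤ V₁ := inf_le_left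
  have hB₂ : V₂ ⊓ (pre f U ⊓ G₂) ≤ V₂ := inf_le_left
  have hB₂U : V₂ ⊓ (pre f U ⊓ G₂) ≤ pre f U := inf_le_right.trans inf_le_left
  have hB : (V₁ ⊓ G₁) ⊓ (V₂ ⊓ (pre f U ⊓ G₂)) ≤ O := fun _ hy ↦ hG ⟨hy.1.2, hy.2.2.2⟩
  have hfa : app S.f _ (res hOU a') =
      res (hO.trans inf_le_left) t₁ - res (hO.trans inf_le_right) t₂ := by
    rw [haO, app_res, ha, map_sub, res_res, res_res]
  have ht₂' : app S.g _ (res hB₂ t₂ + app S.f _ (res hB₂U a')) = res (hB₂.trans hV₂) s := by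
    rw [map_add, app_g_f, add_zero, app_res, ht₂, res_res]
  obtain ⟨t, ht, ht'⟩ := exists_lift_sup (hB₁.trans hV₁) (hB₂.trans hV₂)
    (by rw [app_res, ht₁, res_res]) ht₂' (t₁ := res hB₁ t₁) (by
      rw [map_add, ← app_res, res_res hB₂U, ← res_res hOU hB, app_res, hfa, map_sub]
      simp only [res_res, add_sub_cancel])
  exact ⟨V₁ ⊓ G₁, _, hB₁, le_sup_left, _, t, Set.subset_inter hKV₁ hKG₁,
    (Set.subset_inter hKV₂ (Set.subset_inter (hK₂x.trans (preimage_singleton_subset_pre hx))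
      hKG₂)).trans Set.subset_union_right, ht, ht'⟩

lemma exists_lift_near_compact (hsep : IsSeparatedMap f) (hlp : IsLocallyProperMap f)
    (hS : S.ShortExact) (h₁ : IsSoft f S.X₁) (hC : IsCompact C) (hCx : C ⊆ f ⁻¹' {x})
    (hCW : C ⊆ W) (s : Sec S.X₃ W) :
    ∃ (V : Opens Y) (hV : V ≤ W) (t : Sec S.X₂ V), C ⊆ V ∧ app S.g V t = res hV s := by
  suffices h : ∃ K : Set Y, IsCompact K ∧ C ∩ C ⊆ K ∧ K ⊆ C ∧
      ∃ (V : Opens Y) (hV : V ≤ W) (t : Sec S.X₂ V), K ⊆ V ∧ app S.g V t = res hV s by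
    obtain ⟨K, -, hCK, -, V, hV, t, hKV, ht⟩ := h
    exact ⟨V, hV, t, fun y hy ↦ hKV (hCK ⟨hy, hy⟩), ht⟩
  refine hC.induction_on (p := fun A ↦ ∃ K : Set Y, IsCompact K ∧ A ∩ C ⊆ K ∧ K ⊆ C ∧
    ∃ (V : Opens Y) (hV : V ≤ W) (t : Sec S.X₂ V), K ⊆ V ∧ app S.g V t = res hV s) ?_ ?_ ?_ ?_
  · refine ⟨∅, isCompact_empty, Set.inter_subset_left, Set.empty_subset _, ⊥, bot_le, 0,
      Set.empty_subset _, sec_ext fun y hy ↦ hy.elim⟩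
  · rintro A B hAB ⟨K, hK, hBK, h⟩
    exact ⟨K, hK, (Set.inter_subset_inter_left _ hAB).trans hBK, h⟩
  · rintro A₁ A₂ ⟨K₁, hK₁, hA₁, hKC₁, V₁, hV₁, t₁, hKV₁, ht₁⟩
      ⟨K₂, hK₂, hA₂, hKC₂, V₂, hV₂, t₂, hKV₂, ht₂⟩
    obtain ⟨B₁, B, -, hB₁B, hB, t, hKB₁, hKB, ht, -⟩ := exists_lift_union hsep hS h₁ hK₁ hK₂
      (hKC₁.trans hCx) (hKC₂.trans hCx) hKV₁ hKV₂ hV₁ hV₂ ht₁ ht₂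
    refine ⟨K₁ ∪ K₂, hK₁.union hK₂, ?_, Set.union_subset hKC₁ hKC₂, B, hB, t,
      Set.union_subset (hKB₁.trans hB₁B) hKB, ht⟩
    rw [Set.union_inter_distrib_right]
    exact Set.union_subset_union hA₁ hA₂
  · intro y hy
    obtain ⟨V, hV, hyV, t, ht⟩ := (epi_iff_locallySurjective S.g).mp hS.epi_g W s y (hCW hy)
    obtain ⟨O, P, -, hyO, -, hPV, hP, hyP⟩ :=
      hlp.exists_mapsProperly_of_mem V.isOpen hyV isOpen_univ (Set.mem_univ (f y))
    have hxO : x ∈ O := hCx hy ▸ hyO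
    exact ⟨interior P, mem_nhdsWithin_of_mem_nhds (isOpen_interior.mem_nhds hyP),
      P ∩ f ⁻¹' {x} ∩ C, isCompact_inter_of_isSeparatedMap hsep
        (hP.isCompact_fiber f.hom.continuous hxO) hC Set.inter_subset_right hCx,
      fun z hz ↦ ⟨⟨interior_subset hz.1, hCx hz.2⟩, hz.2⟩, Set.inter_subset_right, V, hV, t,
      fun z hz ↦ hPV hz.1.1, ht⟩

lemma IsSoft.of_shortExact (hsep : IsSeparatedMap f) (hlp : IsLocallyProperMap f)
    (hS : S.ShortExact) (h₁ : IsSoft f S.X₁) (h₂ : IsSoft f S.X₂) : IsSoft f S.X₃ := by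
  intro x C W hC hCx hCW s
  obtain ⟨V, hV, t, hCV, ht⟩ := exists_lift_near_compact hsep hlp hS h₁ hC hCx hCW s
  obtain ⟨U, t', hx, ht', O, hO, hOU, hCO, h⟩ := h₂ x C V hC hCx hCV t
  refine ⟨U, app S.g _ t', hx, mapsProperly_supp_of_subset ht' (supp_app_subset _ _), O,
    hO.trans hV, hOU, hCO, ?_⟩
  rw [← app_res, h, app_res, ht, res_res]

end Lift

section ProperDirectImage

open Limits Filter

variable {Y X : TopCat.{u}} {f : Y ⟶ X} {M N : AbSheaf Y} {V : Opens Y} {U U' : Opens X}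

section ProperSections

/-- The section of `M` underlying a section of its proper direct image. -/
noncomputable def properVal : Sec ((properDirectImage f).obj M) U →+ Sec M (pre f U) :=
  (properSections f M.obj U).subtype

/-- A section whose support is proper, as a section of the proper direct image. -/
def properMk (s : Sec M (pre f U)) (hs : MapsProperly f (supp s) U) :
    Sec ((properDirectImage f).obj M) U :=
  (⟨s, hs⟩ : properSections f M.obj U)

@[simp]
lemma properVal_properMk (s : Sec M (pre f U)) (hs : MapsProperly f (supp s) U) :
    properVal (properMk s hs) = s := rfl

lemma properVal_injective : Function.Injective (properVal (f := f) (M := M) (U := U)) :=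
  Subtype.val_injective

lemma mapsProperly_supp_properVal (s : Sec ((properDirectImage f).obj M) U) :
    MapsProperly f (supp (properVal s)) U :=
  Subtype.property (p := fun s ↦ s ∈ properSections f M.obj U) s

lemma properVal_res (h : U' ≤ U) (s : Sec ((properDirectImage f).obj M) U) :
    properVal (res h s) = res (pre_mono h) (properVal s) := rfl

lemma properVal_app (φ : M ⟶ N) (s : Sec ((properDirectImage f).obj M) U) :
    properVal (app ((properDirectImage f).map φ) U s) = app φ (pre f U) (properVal s) := rfl

end ProperSections

section LeftExact

variable (φ : M ⟶ N) [hφ : Mono φ]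

include hφ

lemma supp_app_of_mono (s : Sec M V) : supp (app φ V s) = supp s := by
  refine (supp_app_subset φ s).antisymm fun y hy ↦ ?_
  by_contra hn
  obtain ⟨W, hW, hyW, h⟩ := (not_mem_supp_iff (supp_subset s hy)).mp hn
  refine (not_mem_supp_iff (supp_subset s hy)).mpr ⟨W, hW, hyW, ?_⟩ hy
  apply (mono_iff_injective φ).mp hφ W
  rw [app_res, h, map_zero]

lemma mono_properDirectImage_map : Mono ((properDirectImage f).map φ) := by
  rw [mono_iff_injective] at hφ ⊢
  intro U s t h
  apply properVal_injective
  apply hφ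
  rw [← properVal_app, h, properVal_app]

end LeftExact

instance : PreservesFiniteLimits (properDirectImage f) := by
  refine ((properDirectImage f).preservesFiniteLimits_tfae.out 1 3 rfl rfl).mp fun S hS ↦ ?_
  have := hS.2
  refine ⟨exact_of_sections _ fun U (s : Sec ((properDirectImage f).obj S.X₂) U)
    (hs : app ((properDirectImage f).map S.g) U s = 0) ↦ ?_, mono_properDirectImage_map S.f⟩
  obtain ⟨t, ht⟩ := exists_app_f_eq hS.1 (properVal s) (by rw [← properVal_app, hs, map_zero])
  have htU : MapsProperly f (supp t) U := by
    rw [← supp_app_of_mono S.f, ht]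
    exact mapsProperly_supp_properVal s
  exact ⟨(properMk t htU : Sec ((properDirectImage f).obj S.X₁) U), properVal_injective ht⟩

section Coproducts

variable {J : Type u}

open Classical in
lemma IsLocalResolution.exists_of_isCompact {e : J → (N ⟶ N)} (he : IsLocalResolution e)
    {K : Set Y} (hK : IsCompact K) (hKV : K ⊆ V) (s : Sec N V) :
    ∃ (W : Opens Y) (hW : W ≤ V), K ⊆ W ∧
      ∀ᶠ S : Finset J in atTop, ∑ a ∈ S, app (e a) W (res hW s) = res hW s := by
  refine hK.induction_on (p := fun A ↦ ∃ (W : Opens Y) (hW : W ≤ V), A ⊆ W ∧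
    ∀ᶠ S : Finset J in atTop, ∑ a ∈ S, app (e a) W (res hW s) = res hW s) ?_ ?_ ?_ ?_
  · exact ⟨⊥, bot_le, Set.empty_subset _, .of_forall fun S ↦ sec_ext fun y hy ↦ hy.elim⟩
  · rintro A B hAB ⟨W, hW, hBW, hS⟩
    exact ⟨W, hW, hAB.trans hBW, hS⟩
  · rintro A B ⟨W₁, hW₁, hA, hS₁⟩ ⟨W₂, hW₂, hB, hS₂⟩
    refine ⟨W₁ ⊔ W₂, sup_le hW₁ hW₂, Set.union_subset_union hA hB, ?_⟩
    filter_upwards [hS₁, hS₂] with S hS₁ hS₂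
    refine sec_ext fun y hy ↦ ?_
    rcases hy with hy | hy
    · exact ⟨W₁, le_sup_left, hy, by simpa only [map_sum, ← app_res, res_res] using hS₁⟩
    · exact ⟨W₂, le_sup_right, hy, by simpa only [map_sum, ← app_res, res_res] using hS₂⟩
  · intro y hy
    obtain ⟨W, hW, hyW, hS⟩ := he V s y (hKV hy)
    exact ⟨W, mem_nhdsWithin_of_mem_nhds (W.isOpen.mem_nhds hyW), W, hW, subset_rfl, hS⟩

open Classical in
lemma isLocalResolution_properDirectImage_map {e : J → (N ⟶ N)} (he : IsLocalResolution e) :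
    IsLocalResolution (fun a ↦ (properDirectImage f).map (e a)) := by
  intro U s x hx
  have hs := mapsProperly_supp_properVal s
  obtain ⟨W, hW, hCW, hS⟩ := he.exists_of_isCompact (hs.isCompact_fiber f.hom.continuous hx)
    (Set.inter_subset_right.trans (preimage_singleton_subset_pre hx)) (properVal s)
  obtain ⟨O, hO, hxO, hOW⟩ := hs.exists_tube f.hom.continuous hx W.isOpen hCW
  lift O to Opens X using hO
  refine ⟨U ⊓ O, inf_le_left, ⟨hx, hxO⟩, hS.mono fun S hS ↦ properVal_injective ?_⟩
  simp only [map_sum, properVal_app, properVal_res]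
  refine sec_ext fun y hy ↦ ?_
  by_cases hys : y ∈ supp (properVal s)
  · refine ⟨W ⊓ pre f (U ⊓ O), inf_le_right, ⟨hOW ⟨hys, hy.2⟩, hy⟩, ?_⟩
    have h := congrArg (res (inf_le_left : W ⊓ pre f (U ⊓ O) ≤ W)) hS
    simpa only [map_sum, ← app_res, res_res] using h
  · obtain ⟨W', hW', hyW', h⟩ := (not_mem_supp_iff (V := pre f U) hy.1).mp hys
    refine ⟨W' ⊓ pre f (U ⊓ O), inf_le_right, ⟨hyW', hy⟩, ?_⟩
    have h₀ : res (inf_le_left.trans hW' : W' ⊓ pre f (U ⊓ O) ≤ pre f U) (properVal s) = 0 := by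
      rw [← res_res hW' inf_le_left, h, map_zero]
    simp only [map_sum, ← app_res, res_res, h₀, map_zero, Finset.sum_const_zero]

instance (J : Type u) : PreservesColimitsOfShape (Discrete J) (properDirectImage f) :=
  preservesCoproducts_of_isLocalResolution _ fun _ _ h ↦
    isLocalResolution_properDirectImage_map h

end Coproducts

end ProperDirectImage

section AdaptedClass

variable {Y X : TopCat.{u}} {f : Y ⟶ X} {S : ShortComplex (AbSheaf Y)} {U : Opens X} {x : X}

/-- The lift near the support of `s` is matched with the zero lift outside of the support, which
makes it vanish near the boundary of `P`. -/
lemma exists_lift_supp_subset (hsep : IsSeparatedMap f) (hlp : IsLocallyProperMap f)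
    (hS : S.ShortExact) (h₁ : IsSoft f S.X₁) {s : Sec S.X₃ (pre f U)}
    (hs : MapsProperly f (supp s) U) (hx : x ∈ U) :
    ∃ (O : Opens X) (P : Set Y) (A : Opens Y) (hA : A ≤ pre f U) (t : Sec S.X₂ A),
      x ∈ O ∧ O ≤ U ∧ MapsProperly f P O ∧ supp s ∩ f ⁻¹' {x} ⊆ interior P ∧
      P ∩ f ⁻¹' {x} ⊆ A ∧ supp t ⊆ P ∧ app S.g A t = res hA s := by
  have hf := f.hom.continuous
  have hsx := hs.isCompact_fiber hf hx
  have hxU := preimage_singleton_subset_pre (f := f) hx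
  obtain ⟨V, hV, t₂, hCV, ht₂⟩ := exists_lift_near_compact hsep hlp hS h₁ hsx
    Set.inter_subset_right (Set.inter_subset_right.trans hxU) s
  obtain ⟨O, P, hO, hxO, hOU, hPV, hP, hCP⟩ := hlp.exists_mapsProperly hsx
    Set.inter_subset_right V.isOpen hCV U.isOpen hx
  lift O to Opens X using hO
  have hPx := hP.isCompact_fiber hf hxO
  obtain ⟨B₁, B, hB₁, hB₁B, hB, t, hKB₁, hKB, ht, htB₁⟩ :=
    exists_lift_union (K₁ := (P ∩ f ⁻¹' {x}) \ interior P) (V₁ := zeroOpens s) hsep hS h₁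
      (hPx.diff isOpen_interior) hPx (Set.sdiff_subset.trans Set.inter_subset_right)
      Set.inter_subset_right (fun y hy ↦ ⟨hxU hy.1.2, fun hys ↦ hy.2 (hCP ⟨hys, hy.1.2⟩)⟩)
      (Set.inter_subset_left.trans hPV) (zeroOpens_le s) hV (t₁ := 0)
      (by rw [map_zero, res_zeroOpens]) ht₂
  have hA : B ⊓ (⟨interior P, isOpen_interior⟩ ⊔ B₁) ≤ B := inf_le_left
  refine ⟨O, P, _, hA.trans hB, res hA t, hxO, hOU, hP, hCP,
    Set.subset_inter hKB fun y hy ↦ or_iff_not_imp_left.mpr fun hyP ↦ hKB₁ ⟨hy, hyP⟩, ?_,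
    by rw [app_res, ht, res_res]⟩
  rw [map_zero, res_eq_zero_iff] at htB₁
  rw [supp_res]
  rintro y ⟨hyt, -, hyP | hyB₁⟩
  · exact interior_subset hyP
  · exact absurd htB₁ (Set.nonempty_iff_ne_empty.mp ⟨y, hyt, hyB₁⟩)

lemma epi_properDirectImage_map (hsep : IsSeparatedMap f) (hlp : IsLocallyProperMap f)
    (hS : S.ShortExact) (h₁ : IsSoft f S.X₁) : Epi ((properDirectImage f).map S.g) := by
  have hf := f.hom.continuous
  rw [epi_iff_locallySurjective]
  intro U (s' : Sec ((properDirectImage f).obj S.X₃) U) x hx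
  have hs := mapsProperly_supp_properVal s'
  obtain ⟨O, P, A, hA, t, hxO, hOU, hP, hsP, hPA, htP, ht⟩ :=
    exists_lift_supp_subset hsep hlp hS h₁ hs hx
  obtain ⟨O₁, hO₁, hxO₁, hsO₁⟩ := hs.exists_tube hf hx isOpen_interior hsP
  obtain ⟨O₂, hO₂, hxO₂, hPO₂⟩ := hP.exists_tube hf hxO A.isOpen hPA
  lift O₁ to Opens X using hO₁
  lift O₂ to Opens X using hO₂
  have hO : O ⊓ (O₁ ⊓ O₂) ≤ O := inf_le_left
  have hP' : MapsProperly f (P ∩ pre f (O ⊓ (O₁ ⊓ O₂))) (O ⊓ (O₁ ⊓ O₂) : Opens X) :=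
    hP.restrict hf hO
  obtain ⟨t', ht', hts⟩ := exists_extend_zero_of_mapsProperly hsep hP'
    (inf_le_right : A ⊓ pre f (O ⊓ (O₁ ⊓ O₂)) ≤ _)
    (Set.subset_inter (fun y hy ↦ hPO₂ ⟨hy.1, hy.2.2.2⟩) Set.inter_subset_right)
    (res inf_le_left t) (by
      rw [supp_res]
      exact Set.inter_subset_inter htP inf_le_right)
  have htP' : supp t' ⊆ P ∩ pre f (O ⊓ (O₁ ⊓ O₂)) := by
    rw [hts, supp_res]
    exact Set.inter_subset_inter htP inf_le_right
  refine ⟨O ⊓ (O₁ ⊓ O₂), hO.trans hOU, ⟨hxO, hxO₁, hxO₂⟩,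
    properMk t' (mapsProperly_supp_of_subset hP' htP'), properVal_injective ?_⟩
  rw [properVal_app, properVal_properMk, properVal_res]
  refine sec_ext fun y hy ↦ ?_
  by_cases hyP : y ∈ P
  · refine ⟨_, inf_le_right, ⟨hPO₂ ⟨hyP, hy.2.2⟩, hy⟩, ?_⟩
    rw [← app_res, ht', app_res, ht, res_res, res_res]
  · have hle := properCompl_le hsep hP'
    refine ⟨properCompl hsep hP', hle, ⟨hy, fun h ↦ hyP h.1⟩, ?_⟩
    have ht₀ : res hle t' = 0 :=
      res_properCompl_eq_zero hsep hP' hle (Set.inter_subset_left.trans htP')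
    have hs₀ : res (hle.trans (pre_mono (hO.trans hOU))) (properVal s') = 0 :=
      res_properCompl_eq_zero hsep hP' _ fun z hz ↦
        ⟨interior_subset (hsO₁ ⟨hz.1, hz.2.2.1⟩), hz.2⟩
    rw [← app_res, ht₀, map_zero, res_res, hs₀]

lemma isAdaptedClass_isSoft (hsep : IsSeparatedMap f) (hlp : IsLocallyProperMap f) :
    IsAdaptedClass (properDirectImage f) (IsSoft f) where
  injective I _ := isSoft_of_injective hsep hlp I
  quotient _ hS h₁ h₂ := h₁.of_shortExact hsep hlp hS h₂
  epi_map _ hS h₁ := epi_properDirectImage_map hsep hlp hS h₁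

end AdaptedClass

end AbSheaf

theorem theoremt {Y X : TopCat.{u}} (f : Y ⟶ X)
    [HasDerivedCategory.{w₁} (TopCat.Sheaf AddCommGrpCat.{u} Y)]
    [HasDerivedCategory.{w₂} (TopCat.Sheaf AddCommGrpCat.{u} X)]
    (hsep : IsSeparatedMap f) (hlp : IsLocallyProperMap f)
    (hfin : HasFiniteCohomologicalDimension f) :
    ∃ fUpperShriek : DerivedCategory.Plus (TopCat.Sheaf AddCommGrpCat.{u} X) ⥤
        DerivedCategory.Plus (TopCat.Sheaf AddCommGrpCat.{u} Y),
      Nonempty (derivedProperDirectImage f ⊣ fUpperShriek) := by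
  obtain ⟨d, hd⟩ := hfin
  exact exists_rightAdjoint_rightDerivedFunctorPlus (AbSheaf.isAdaptedClass_isSoft hsep hlp)
    (AbSheaf.toFinSheaf Y) (AbSheaf.isSoft_finSheaf hsep hlp) (hd (d + 1) d.lt_succ_self)
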